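/- Let $G_{n,p}$ denote the binomial random graph on $n$ labelled vertices in which each pair of vertices is an edge independently with probability $p$. A red/blue-colouring of the edges of a graph is called $K_3$-free if it contains no monochromatic triangle. Let $C_{rrbb}$ denote the coloured $4$-cycle that has two adjacent red edges and two adjacent blue edges. For functions $f,g$ of $n$, write $f\ll g$ if $f(n)/g(n)\to 0$ as $n\to\infty$. There exist absolute constants $\beta,\zeta>0$ such that the following holds. Let $p=p(n)\in[0,1]$ satisfy $n^{-3/5}\ll p\ll n^{-1/2}$ and let $G\sim G_{n,p}$. Then, with probability tending to $1$ as $n\to\infty$, every $K_3$-free colouring $\varphi\colon E(G)\to\{\mathrm{red},\mathrm{blue}\}$ with $|\varphi^{-1}(\mathrm{red})|<\beta n^2p$ contains at least $\zeta n^6p^8$ copies of $C_{rrbb}$. -/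

import Mathlib

/-- The two colours. -/
inductive RBColour : Type
  | red : RBColour
  | blue : RBColour

/-- A red/blue-colouring of the edges of `G`: a map from the edge set of `G` to the two colours. -/
abbrev RBColouring {V : Type*} (G : SimpleGraph V) : Type _ :=
  G.EdgeLabeling RBColour

namespace RBColouring

variable {V : Type*} {G : SimpleGraph V}

/-- The colouring contains no monochromatic triangle. -/
def IsTriangleFree (φ : RBColouring G) : Prop :=
  ∀ c : RBColour, (φ.labelGraph c).CliqueFree 3

/-- The number of edges of colour `c`, that is, the size of the preimage of `c` under `φ`. -/
noncomputable def colourCount (φ : RBColouring G) (c : RBColour) : ℕ :=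
  {e : G.edgeSet | φ e = c}.ncard

/-- `C` is the edge set of a `4`-cycle `x u y v` of `G` in which the two edges at `u` are red and
the two edges at `v` are blue. -/
def IsRRBBCycle (φ : RBColouring G) (C : Set (Sym2 V)) : Prop :=
  ∃ x u y v : V, x ≠ y ∧ u ≠ v ∧
    (φ.labelGraph .red).Adj x u ∧ (φ.labelGraph .red).Adj u y ∧
    (φ.labelGraph .blue).Adj y v ∧ (φ.labelGraph .blue).Adj v x ∧
    C = {s(x, u), s(u, y), s(y, v), s(v, x)}

/-- The number of (unlabelled) copies in `G`, coloured by `φ`, of the `4`-cycle with two adjacent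
red edges and two adjacent blue edges. A copy is determined by its set of edges. -/
noncomputable def rrbbCount (φ : RBColouring G) : ℕ :=
  {C : Set (Sym2 V) | φ.IsRRBBCycle C}.ncard

end RBColouring

/-!
Let `N` be the edge set of the random graph and `R` the set of red edges. The absence of blue
triangles says that `R` meets every triangle of `N`. The number of red edges is not known, and a
union bound over all possible `R` fails when `R` is small: `N` contains about
`exp (m log (n ^ 2 p / m))` sets of `m` edges, while the number of `4`-cycles with two adjacent edges
in `R` has expectation of order `p ^ 2 m ^ 2`, which is of order `n ^ 3 p ^ 5` times `m` if `m` is the number `n ^ 3 p ^ 3` of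
triangles. For `p` close to `n ^ (-3 / 5)` this does not beat the logarithm. The proof therefore
separates small from large `R`.

*Large `R`* (`subsetPr_exists_large_le`). Fix `R` with `m` edges. Given `R ⊆ N`, the blue edges are a
random subset of the remaining pairs. There are at least of order `m ^ 2 / n` paths of length two in
`R`, and each of them has about `n` possible completions (closings) by two edges outside `R`; all
completed `4`-cycles are of the required kind. The number of closings inside `N` has a lower tail of
Janson type (`subsetEx_exp_neg_le`). This requires that the closings are weakly correlated, which is
achieved by `exists_cherries`: a subfamily of the paths is chosen such that no vertex is an endpoint
of too many of them, using that small vertex sets of a typical graph span few edges. The resulting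
exponent exceeds `m log (n ^ 2 p / m)` if `m` is at most a small multiple of `n ^ 2 p` and
`p ^ 2 m` is at least a multiple of `κ log n`, where `κ` bounds the codegrees.

*Small `R`* (`HasWitnessFamily.grow`). It is shown that `R` cannot be small unless there are many
`4`-cycles of the required kind. By `subsetPr_superset_and_not_hasPacking_le` the graph contains
of order `n ^ 3 p ^ 3` edge-disjoint triangles, and `R` contains an edge of each. Choosing the
triangles and these edges costs, in expectation, only a factor exponential in their number, without
a logarithm. Given such a part `P` of `R` with `m` edges, there are of order `p ^ 2 m ^ 2` disjoint
closings of `P` in `N`. If half of them avoid `R`, the required `4`-cycles are found. Otherwise `R`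
contains an edge from many of them, and the choice of these closings and edges costs again only a
factor exponential in their number. So the forced part of `R` grows from `m` to a multiple of
`p ^ 2 m ^ 2`, which is larger than `m` since `p ^ 2 m ≥ n ^ 3 p ^ 5 / 12288` is large. This is
iterated until the forced part is large in the sense above. The iteration is needed only if `p` is
less than `n ^ (-11 / 20)`, where codegrees are bounded by a constant; for larger `p` the triangles
alone make `R` large.
-/

open Finset

/-! ### Random subsets and a lower tail bound -/

section RandomSubset

variable {α : Type*}

/-- The expectation of `f N` where `N` is a random subset of `U` containing each element
independently with probability `p`. -/
noncomputable def subsetEx (U : Finset α) (p : ℝ) (f : Finset α → ℝ) : ℝ :=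
  ∑ N ∈ U.powerset, p ^ #N * (1 - p) ^ (#U - #N) * f N

open Classical in
/-- The probability that a random subset of `U`, containing each element independently with
probability `p`, satisfies `A`. -/
noncomputable def subsetPr (U : Finset α) (p : ℝ) (A : Finset α → Prop) : ℝ :=
  subsetEx U p fun N => if A N then 1 else 0

lemma subsetEx_mono {U : Finset α} {p : ℝ} (hp0 : 0 ≤ p) (hp1 : p ≤ 1) {f g : Finset α → ℝ}
    (h : ∀ N ⊆ U, f N ≤ g N) : subsetEx U p f ≤ subsetEx U p g := by
  refine sum_le_sum fun N hN => ?_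
  have h1 : 0 ≤ 1 - p := by linarith
  exact mul_le_mul_of_nonneg_left (h N (mem_powerset.1 hN)) (by positivity)

lemma subsetEx_congr {U : Finset α} {p : ℝ} {f g : Finset α → ℝ}
    (h : ∀ N ⊆ U, f N = g N) : subsetEx U p f = subsetEx U p g :=
  sum_congr rfl fun N hN => by rw [h N (mem_powerset.1 hN)]

lemma subsetEx_one (U : Finset α) (p : ℝ) : subsetEx U p (fun _ => 1) = 1 := by
  simp only [subsetEx, mul_one]
  rw [Finset.sum_pow_mul_eq_add_pow]
  simp

lemma subsetEx_add (U : Finset α) (p : ℝ) (f g : Finset α → ℝ) :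
    subsetEx U p (fun N => f N + g N) = subsetEx U p f + subsetEx U p g := by
  simp [subsetEx, mul_add, sum_add_distrib]

lemma subsetEx_sub (U : Finset α) (p : ℝ) (f g : Finset α → ℝ) :
    subsetEx U p (fun N => f N - g N) = subsetEx U p f - subsetEx U p g := by
  simp [subsetEx, mul_sub, sum_sub_distrib]

lemma subsetEx_const_mul (U : Finset α) (p c : ℝ) (f : Finset α → ℝ) :
    subsetEx U p (fun N => c * f N) = c * subsetEx U p f := by
  simp only [subsetEx, mul_sum]
  exact sum_congr rfl fun N _ => by ring

lemma subsetEx_sum {ι : Type*} (U : Finset α) (p : ℝ) (I : Finset ι) (f : ι → Finset α → ℝ) :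
    subsetEx U p (fun N => ∑ i ∈ I, f i N) = ∑ i ∈ I, subsetEx U p (f i) := by
  simp only [subsetEx, mul_sum]
  exact sum_comm

lemma subsetEx_nonneg {U : Finset α} {p : ℝ} (hp0 : 0 ≤ p) (hp1 : p ≤ 1) {f : Finset α → ℝ}
    (h : ∀ N, 0 ≤ f N) : 0 ≤ subsetEx U p f := by
  have h1 : 0 ≤ 1 - p := by linarith
  exact sum_nonneg fun N _ => mul_nonneg (by positivity) (h N)

lemma subsetPr_le_subsetEx {U : Finset α} {p : ℝ} (hp0 : 0 ≤ p) (hp1 : p ≤ 1)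
    {A : Finset α → Prop} {f : Finset α → ℝ} (h0 : ∀ N ⊆ U, 0 ≤ f N)
    (h : ∀ N ⊆ U, A N → 1 ≤ f N) : subsetPr U p A ≤ subsetEx U p f := by
  classical
  refine subsetEx_mono hp0 hp1 fun N hN => ?_
  split_ifs with hA
  · exact h N hN hA
  · exact h0 N hN

lemma subsetPr_mono {U : Finset α} {p : ℝ} (hp0 : 0 ≤ p) (hp1 : p ≤ 1)
    {A B : Finset α → Prop} (h : ∀ N ⊆ U, A N → B N) : subsetPr U p A ≤ subsetPr U p B := by
  classical
  refine subsetEx_mono hp0 hp1 fun N hN => ?_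
  by_cases hA : A N
  · simp [hA, h N hN hA]
  · simp only [hA, if_false]
    split_ifs <;> simp

lemma subsetPr_or_le {U : Finset α} {p : ℝ} (hp0 : 0 ≤ p) (hp1 : p ≤ 1)
    {A B : Finset α → Prop} :
    subsetPr U p (fun N => A N ∨ B N) ≤ subsetPr U p A + subsetPr U p B := by
  classical
  unfold subsetPr
  rw [← subsetEx_add]
  refine subsetEx_mono hp0 hp1 fun N hN => ?_
  by_cases hA : A N <;> by_cases hB : B N <;> simp [hA, hB]

lemma subsetPr_exists_le {ι : Type*} {U : Finset α} {p : ℝ} (hp0 : 0 ≤ p) (hp1 : p ≤ 1)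
    (I : Finset ι) (A : ι → Finset α → Prop) :
    subsetPr U p (fun N => ∃ i ∈ I, A i N) ≤ ∑ i ∈ I, subsetPr U p (A i) := by
  classical
  unfold subsetPr
  rw [← subsetEx_sum]
  refine subsetEx_mono hp0 hp1 fun N hN => ?_
  split_ifs with h
  · obtain ⟨i, hi, hAi⟩ := h
    refine le_trans (le_of_eq ?_) (single_le_sum (f := fun i => if A i N then (1 : ℝ) else 0)
      (fun j _ => by split_ifs <;> simp) hi)
    simp [hAi]
  · exact sum_nonneg fun j _ => by split_ifs <;> simp

lemma subsetPr_compl (U : Finset α) (p : ℝ) (A : Finset α → Prop) :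
    subsetPr U p (fun N => ¬ A N) = 1 - subsetPr U p A := by
  classical
  rw [← subsetEx_one U p]
  unfold subsetPr
  rw [← subsetEx_sub]
  refine subsetEx_congr fun N _ => ?_
  by_cases hA : A N <;> simp [hA]

variable [DecidableEq α]

lemma subsetEx_insert {U : Finset α} {e : α} (he : e ∉ U) (p : ℝ) (f : Finset α → ℝ) :
    subsetEx (insert e U) p f
      = (1 - p) * subsetEx U p f + p * subsetEx U p (fun N => f (insert e N)) := by
  unfold subsetEx
  rw [sum_powerset_insert he, mul_sum, mul_sum]
  congr 1
  · refine sum_congr rfl fun N hN => ?_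
    have h1 := card_le_card (mem_powerset.1 hN)
    rw [card_insert_of_notMem he, Nat.sub_add_comm h1, pow_succ]
    ring
  · refine sum_congr rfl fun N hN => ?_
    have h1 : e ∉ N := fun h => he (mem_powerset.1 hN h)
    rw [card_insert_of_notMem he, card_insert_of_notMem h1, Nat.add_sub_add_right, pow_succ]
    ring

/-- Conditioning on the event `A ⊆ N` amounts to adding `A` to the random subset. -/
lemma subsetEx_superset {U A : Finset α} (hA : A ⊆ U) (p : ℝ) (f : Finset α → ℝ) :
    subsetEx U p (fun N => if A ⊆ N then f N else 0)
      = p ^ #A * subsetEx U p (fun N => f (N ∪ A)) := by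
  induction A using Finset.induction_on generalizing f with
  | empty => simp
  | insert e A he ih =>
    have heU : e ∈ U := hA (mem_insert_self e A)
    have hAU : A ⊆ U := (subset_insert e A).trans hA
    have key : ∀ g : Finset α → ℝ, subsetEx U p (fun N => if e ∈ N then g N else 0)
        = p * subsetEx U p (fun N => g (insert e N)) := by
      intro g
      obtain ⟨U', hU', rfl⟩ : ∃ U', e ∉ U' ∧ insert e U' = U :=
        ⟨U.erase e, by simp, insert_erase heU⟩
      rw [subsetEx_insert hU', subsetEx_insert hU']
      have h1 : subsetEx U' p (fun N => if e ∈ N then g N else 0) = 0 := by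
        refine sum_eq_zero fun N hN => ?_
        have : e ∉ N := fun h => hU' (mem_powerset.1 hN h)
        simp [this]
      simp only [mem_insert_self, if_true, insert_idem]
      rw [h1]
      ring
    have h2 : ∀ N : Finset α, (if insert e A ⊆ N then f N else 0)
        = if A ⊆ N then (if e ∈ N then f N else 0) else 0 := by
      intro N
      by_cases h : A ⊆ N <;> by_cases h' : e ∈ N <;> simp [insert_subset_iff, h, h']
    simp only [h2]
    have h3 : ∀ N : Finset α, N ∪ insert e A = insert e N ∪ A := fun N => by
      rw [union_insert, insert_union]
    simp only [h3]
    rw [ih hAU, card_insert_of_notMem he, pow_succ, mul_assoc, ← key fun N => f (N ∪ A)]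
    congr 1
    refine subsetEx_congr fun N _ => ?_
    have : e ∈ N ∪ A ↔ e ∈ N := by simp [he]
    simp [this]

lemma subsetPr_superset {U A : Finset α} (hA : A ⊆ U) (p : ℝ) :
    subsetPr U p (fun N => A ⊆ N) = p ^ #A := by
  have := subsetEx_superset hA p (fun _ => 1)
  rw [subsetEx_one, mul_one] at this
  rw [← this]
  exact subsetEx_congr fun N _ => by simp

/-- The case of the Harris inequality in which one of the events is `A ⊆ N`. -/
lemma subsetEx_superset_le {U A : Finset α} (hA : A ⊆ U) {p : ℝ} (hp0 : 0 ≤ p) (hp1 : p ≤ 1)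
    {f : Finset α → ℝ} (hf : Antitone f) :
    subsetEx U p (fun N => if A ⊆ N then f N else 0) ≤ p ^ #A * subsetEx U p f := by
  rw [subsetEx_superset hA]
  exact mul_le_mul_of_nonneg_left
    (subsetEx_mono hp0 hp1 fun N _ => hf subset_union_left) (by positivity)

/-- The Chernoff-type bound which results from the expectation of `2 ^ |F ∩ N|`. -/
lemma subsetPr_card_inter_ge_le {U F : Finset α} (hF : F ⊆ U) {p : ℝ} (hp0 : 0 ≤ p) (hp1 : p ≤ 1)
    (t : ℝ) :
    subsetPr U p (fun N => t ≤ #(F ∩ N)) ≤ 2 ^ (-t) * Real.exp (p * #F) := by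
  have h1 : subsetEx U p (fun N => (2 : ℝ) ^ #(F ∩ N)) = (1 + p) ^ #F := by
    have h2 : ∀ N : Finset α, (2 : ℝ) ^ #(F ∩ N)
        = ∑ B ∈ F.powerset, if B ⊆ N then (1 : ℝ) else 0 := by
      intro N
      have h3 : F.powerset.filter (fun B => B ⊆ N) = (F ∩ N).powerset := by
        ext B
        rw [mem_filter, mem_powerset, mem_powerset, subset_inter_iff]
      rw [← sum_filter, h3, sum_const, card_powerset, nsmul_eq_mul]
      simp only [Nat.cast_pow, Nat.cast_ofNat, mul_one]
    simp only [h2]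
    rw [subsetEx_sum, add_comm (1 : ℝ) p, ← Finset.sum_pow_mul_eq_add_pow]
    refine sum_congr rfl fun B hB => ?_
    rw [one_pow, mul_one, subsetEx_superset ((mem_powerset.1 hB).trans hF) p (fun _ => 1),
      subsetEx_one, mul_one]
  have h2 : subsetPr U p (fun N => t ≤ #(F ∩ N))
      ≤ subsetEx U p (fun N => (2 : ℝ) ^ (-t) * 2 ^ #(F ∩ N)) := by
    refine subsetPr_le_subsetEx hp0 hp1 (fun N _ => by positivity) fun N _ ht => ?_
    rw [← Real.rpow_natCast, ← Real.rpow_add (by norm_num)]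
    exact Real.one_le_rpow (by norm_num) (by linarith)
  rw [subsetEx_const_mul, h1] at h2
  refine h2.trans (mul_le_mul_of_nonneg_left ?_ (by positivity))
  calc (1 + p) ^ #F ≤ (Real.exp p) ^ #F := by
        gcongr
        linarith [Real.add_one_le_exp p]
    _ = Real.exp (p * #F) := by rw [← Real.exp_nat_mul]; ring_nf

end RandomSubset

section LowerTail

variable {α ι : Type*} [DecidableEq α] [DecidableEq ι]

lemma half_le_one_sub_exp_neg {s : ℝ} (h0 : 0 ≤ s) (h1 : s ≤ 1) :
    s / 2 ≤ 1 - Real.exp (-s) := by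
  have h2 : Real.exp (-s) ≤ 1 / (1 + s) := by
    rw [Real.exp_neg, one_div]
    gcongr
    linarith [Real.add_one_le_exp s]
  have h3 : 1 / (1 + s) ≤ 1 - s / 2 := by
    rw [div_le_iff₀ (by linarith)]
    nlinarith
  linarith

/-- Lower tail of Janson type, for the number of members of an `r`-uniform family which are
contained in a random set. The members are removed one at a time, and the one-sided Harris
inequality shows that each removal costs a factor of at most `1 - (s / 4) p ^ r`. -/
lemma subsetEx_exp_neg_le {U : Finset α} {p : ℝ} (hp0 : 0 ≤ p) (hp1 : p ≤ 1) (I : Finset ι)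
    (A : ι → Finset α) (hA : ∀ i ∈ I, A i ⊆ U) (r : ℕ) (hr : ∀ i ∈ I, #(A i) = r)
    {s : ℝ} (hs0 : 0 ≤ s) (hs1 : s ≤ 1)
    (hI : ∀ i ∈ I, s * ∑ j ∈ I with j ≠ i ∧ ¬ Disjoint (A i) (A j), p ^ #(A j \ A i) ≤ 1 / 2) :
    subsetEx U p (fun N => Real.exp (-s * #{i ∈ I | A i ⊆ N}))
      ≤ Real.exp (-s * p ^ r * #I / 4) := by
  induction I using Finset.induction_on with
  | empty => simp [subsetEx_one]
  | insert i I hi ih =>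
    have ih' := ih (fun j hj => hA j (mem_insert_of_mem hj)) (fun j hj => hr j (mem_insert_of_mem hj))
      (fun j hj => by
        refine le_trans (mul_le_mul_of_nonneg_left ?_ hs0) (hI j (mem_insert_of_mem hj))
        exact sum_le_sum_of_subset_of_nonneg (filter_subset_filter _ (subset_insert _ _))
          fun _ _ _ => by positivity)
    set g : ℝ := subsetEx U p (fun N => Real.exp (-s * #{j ∈ I | A j ⊆ N})) with hg
    have hg0 : 0 ≤ g := subsetEx_nonneg hp0 hp1 fun N => (Real.exp_pos _).le
    set c : ℝ := 1 - Real.exp (-s) with hc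
    have hc2 : s / 2 ≤ c := half_le_one_sub_exp_neg hs0 hs1
    have hAi : A i ⊆ U := hA i (mem_insert_self i I)
    -- removing the member `i`
    have h1 : subsetEx U p (fun N => Real.exp (-s * #{j ∈ insert i I | A j ⊆ N}))
        = g - c * (p ^ r * subsetEx U p
            (fun N => Real.exp (-s * #{j ∈ I | A j ⊆ N ∪ A i}))) := by
      rw [← hr i (mem_insert_self i I),
        ← subsetEx_superset hAi p (fun N => Real.exp (-s * #{j ∈ I | A j ⊆ N})),
        ← subsetEx_const_mul, hg, ← subsetEx_sub]
      refine subsetEx_congr fun N _ => ?_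
      rw [filter_insert]
      split_ifs with h
      · rw [card_insert_of_notMem (by simp [hi])]
        push_cast
        rw [mul_add, Real.exp_add, hc]
        ring_nf
      · ring_nf
    set J : Finset ι := {j ∈ I | ¬ Disjoint (A i) (A j)} with hJ
    set J' : Finset ι := {j ∈ I | Disjoint (A i) (A j)} with hJ'
    set f : Finset α → ℝ := fun N => Real.exp (-s * #{j ∈ J' | A j ⊆ N}) with hf
    have hfanti : Antitone f := by
      intro N N' hN
      refine Real.exp_le_exp.2 ?_
      have : #{j ∈ J' | A j ⊆ N} ≤ #{j ∈ J' | A j ⊆ N'} :=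
        card_le_card fun j hj => by
          simp only [mem_filter] at hj ⊢
          exact ⟨hj.1, hj.2.trans hN⟩
      have : (#{j ∈ J' | A j ⊆ N} : ℝ) ≤ #{j ∈ J' | A j ⊆ N'} := by exact_mod_cast this
      nlinarith
    have hgf : g ≤ subsetEx U p f := by
      refine subsetEx_mono hp0 hp1 fun N _ => Real.exp_le_exp.2 ?_
      have : #{j ∈ J' | A j ⊆ N} ≤ #{j ∈ I | A j ⊆ N} :=
        card_le_card (filter_subset_filter _ (filter_subset _ _))
      have : (#{j ∈ J' | A j ⊆ N} : ℝ) ≤ #{j ∈ I | A j ⊆ N} := by exact_mod_cast this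
      nlinarith
    have h2 : (1 / 2) * g
        ≤ subsetEx U p (fun N => Real.exp (-s * #{j ∈ I | A j ⊆ N ∪ A i})) := by
      have h3 : ∀ N ⊆ U, f N - s * ∑ j ∈ J, (if A j \ A i ⊆ N then f N else 0)
          ≤ Real.exp (-s * #{j ∈ I | A j ⊆ N ∪ A i}) := by
        intro N _
        set Y : Finset ι := {j ∈ J | A j \ A i ⊆ N} with hY
        have h4 : #{j ∈ I | A j ⊆ N ∪ A i} ≤ #{j ∈ J' | A j ⊆ N} + #Y := by
          refine le_trans (card_le_card ?_) (card_union_le _ _)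
          intro j hj
          simp only [mem_filter, mem_union, hY, hJ, hJ'] at hj ⊢
          by_cases hd : Disjoint (A i) (A j)
          · left
            refine ⟨⟨hj.1, hd⟩, fun x hx => ?_⟩
            rcases mem_union.1 (hj.2 hx) with h | h
            · exact h
            · exact absurd hx (Finset.disjoint_left.1 hd h)
          · right
            refine ⟨⟨hj.1, hd⟩, fun x hx => ?_⟩
            rw [mem_sdiff] at hx
            rcases mem_union.1 (hj.2 hx.1) with h | h
            · exact h
            · exact absurd h hx.2
        have h5 : ∑ j ∈ J, (if A j \ A i ⊆ N then f N else 0) = #Y * f N := by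
          rw [← sum_filter, sum_const, nsmul_eq_mul]
        rw [h5]
        have h6 : (#{j ∈ I | A j ⊆ N ∪ A i} : ℝ) ≤ #{j ∈ J' | A j ⊆ N} + #Y := by
          exact_mod_cast h4
        have h7 : f N * Real.exp (-s * #Y) ≤ Real.exp (-s * #{j ∈ I | A j ⊆ N ∪ A i}) := by
          rw [hf, ← Real.exp_add]
          refine Real.exp_le_exp.2 ?_
          nlinarith
        refine le_trans ?_ h7
        have h8 : -s * #Y + 1 ≤ Real.exp (-s * #Y) := Real.add_one_le_exp _
        have h9 : 0 ≤ f N := (Real.exp_pos _).le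
        nlinarith
      refine le_trans ?_ (subsetEx_mono hp0 hp1 h3)
      rw [subsetEx_sub, subsetEx_const_mul, subsetEx_sum]
      have h4 : ∑ j ∈ J, subsetEx U p (fun N => if A j \ A i ⊆ N then f N else 0)
          ≤ ∑ j ∈ J, p ^ #(A j \ A i) * subsetEx U p f := by
        refine sum_le_sum fun j hj => subsetEx_superset_le ?_ hp0 hp1 hfanti
        exact sdiff_subset.trans (hA j (mem_insert_of_mem (mem_filter.1 hj).1))
      rw [← sum_mul] at h4
      have h5 := hI i (mem_insert_self i I)
      have h6 : ({j ∈ insert i I | j ≠ i ∧ ¬ Disjoint (A i) (A j)} : Finset ι) = J := by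
        ext j
        simp only [mem_filter, mem_insert, hJ]
        constructor
        · rintro ⟨h | h, h', h''⟩
          · exact absurd h h'
          · exact ⟨h, h''⟩
        · rintro ⟨h, h'⟩
          exact ⟨Or.inr h, fun e => hi (e ▸ h), h'⟩
      rw [h6] at h5
      have hEf : 0 ≤ subsetEx U p f := hg0.trans hgf
      nlinarith [mul_le_mul_of_nonneg_left h4 hs0, mul_le_mul_of_nonneg_right h5 hEf]
    rw [h1]
    have hpr : 0 ≤ p ^ r := by positivity
    have h3 : g - c * (p ^ r * subsetEx U p
        (fun N => Real.exp (-s * #{j ∈ I | A j ⊆ N ∪ A i}))) ≤ g * (1 - s * p ^ r / 4) := by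
      have h4 := mul_le_mul_of_nonneg_left h2 hpr
      have h5 : s / 2 * (p ^ r * (1 / 2 * g)) ≤ c * (p ^ r * subsetEx U p
        (fun N => Real.exp (-s * #{j ∈ I | A j ⊆ N ∪ A i}))) := by
        apply mul_le_mul hc2 h4 (by positivity) (by linarith)
      linarith
    refine h3.trans ?_
    have h4 : 1 - s * p ^ r / 4 ≤ Real.exp (-s * p ^ r / 4) := by
      have := Real.add_one_le_exp (-s * p ^ r / 4)
      linarith
    calc g * (1 - s * p ^ r / 4) ≤ Real.exp (-s * p ^ r * #I / 4) * Real.exp (-s * p ^ r / 4) := by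
          refine (mul_le_mul_of_nonneg_left h4 hg0).trans ?_
          exact mul_le_mul_of_nonneg_right ih' (Real.exp_pos _).le
      _ = Real.exp (-s * p ^ r * #(insert i I) / 4) := by
          rw [← Real.exp_add, card_insert_of_notMem hi]
          push_cast
          ring_nf

end LowerTail

/-! ### Packings in random subsets -/

section Packing

variable {α ι : Type*} [DecidableEq α] [DecidableEq ι]

/-- `N` contains `k` pairwise disjoint members of the family `A` indexed by `I`. -/
def HasPacking (I : Finset ι) (A : ι → Finset α) (k : ℕ) (N : Finset α) : Prop :=
  ∃ M ⊆ I, #M = k ∧ (M : Set ι).PairwiseDisjoint A ∧ ∀ i ∈ M, A i ⊆ N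

omit [DecidableEq α] [DecidableEq ι] in
lemma HasPacking.mono {I : Finset ι} {A : ι → Finset α} {k : ℕ} {N N' : Finset α} (hN : N ⊆ N')
    (h : HasPacking I A k N) : HasPacking I A k N' := by
  obtain ⟨M, hM, hk, hd, h⟩ := h
  exact ⟨M, hM, hk, hd, fun i hi => (h i hi).trans hN⟩

lemma subsetPr_superset_and_le {U W : Finset α} (hW : W ⊆ U) {p : ℝ} (hp0 : 0 ≤ p) (hp1 : p ≤ 1)
    {B : Finset α → Prop} (hB : ∀ ⦃N N' : Finset α⦄, N ⊆ N' → B N' → B N) :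
    subsetPr U p (fun N => W ⊆ N ∧ B N) ≤ p ^ #W * subsetPr U p B := by
  classical
  refine le_trans (le_of_eq ?_) (subsetEx_superset_le hW hp0 hp1
    (f := fun N => if B N then 1 else 0) ?_)
  · refine subsetEx_congr fun N _ => ?_
    by_cases h : W ⊆ N <;> simp [h]
  · intro N N' h
    by_cases hb : B N'
    · simp [hb, hB h hb]
    · simp only [hb, if_false]
      split_ifs <;> simp

/-- A maximal packing inside a set which contains no packing of size `k`. -/
lemma exists_maximal_packing {I : Finset ι} {A : ι → Finset α} {k : ℕ} {N : Finset α}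
    (h : ¬ HasPacking I A k N) :
    ∃ M ∈ I.powerset, #M < k ∧ (M : Set ι).PairwiseDisjoint A ∧ M.biUnion A ⊆ N ∧
      ∀ i ∈ I, Disjoint (A i) (M.biUnion A) → i ∉ M → ¬ A i ⊆ N := by
  classical
  set 𝓜 : Finset (Finset ι) :=
    {M ∈ I.powerset | (M : Set ι).PairwiseDisjoint A ∧ M.biUnion A ⊆ N} with h𝓜
  have hne : 𝓜.Nonempty := ⟨∅, by simp [h𝓜]⟩
  obtain ⟨M, hM, hmax⟩ := exists_max_image 𝓜 card hne
  have hM' := (mem_filter.1 hM)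
  refine ⟨M, hM'.1, ?_, hM'.2.1, hM'.2.2, ?_⟩
  · by_contra hk
    obtain ⟨M', hM'M, hcard⟩ := exists_subset_card_eq (not_lt.1 hk)
    exact h ⟨M', hM'M.trans (mem_powerset.1 hM'.1), hcard,
      hM'.2.1.subset (by exact_mod_cast hM'M),
      fun i hi => (subset_biUnion_of_mem A (hM'M hi)).trans hM'.2.2⟩
  · intro i hi hd hiM hiN
    have : insert i M ∈ 𝓜 := by
      rw [h𝓜, mem_filter, mem_powerset]
      refine ⟨insert_subset hi (mem_powerset.1 hM'.1), ?_, ?_⟩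
      · rw [coe_insert]
        refine hM'.2.1.insert fun j hj _ => ?_
        exact hd.mono_right (subset_biUnion_of_mem A hj)
      · rw [biUnion_insert]
        exact union_subset hiN hM'.2.2
    have := hmax _ this
    rw [card_insert_of_notMem hiM] at this
    omega

/-- A family which satisfies the hypotheses of the lower tail bound with expectation
`μ = p ^ r * #I` has a packing of size proportional to `μ` inside a random set, except with
probability exponentially small in `μ`. Outside a maximal packing there is no further member, so a
union bound over small packings reduces this to the lower tail. -/
lemma subsetPr_superset_and_not_hasPacking_le {U W : Finset α} (hW : W ⊆ U) {p : ℝ} (hp0 : 0 < p)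
    (hp1 : p ≤ 1) (I : Finset ι) (A : ι → Finset α) (hA : ∀ i ∈ I, A i ⊆ U) (r : ℕ) (hr0 : r ≠ 0)
    (hr : ∀ i ∈ I, #(A i) = r) {s : ℝ} (hs0 : 0 < s) (hs1 : s ≤ 1)
    (hI : ∀ i ∈ I, s * ∑ j ∈ I with j ≠ i ∧ ¬ Disjoint (A i) (A j), p ^ #(A j \ A i) ≤ 1 / 2)
    (k : ℕ) (hk : 512 * k ≤ s ^ 2 * (p ^ r * #I)) :
    subsetPr U p (fun N => W ⊆ N ∧ ¬ HasPacking I A k N)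
      ≤ p ^ #W * Real.exp (-s * (p ^ r * #I) / 32) := by
  classical
  set μ : ℝ := p ^ r * #I with hμ
  have hpr : 0 < p ^ r := by positivity
  have hμ0 : 0 ≤ μ := by positivity
  refine (subsetPr_superset_and_le hW hp0.le hp1 fun N N' h h' h'' => h' (h''.mono h)).trans ?_
  refine mul_le_mul_of_nonneg_left ?_ (by positivity)
  set 𝓜 : Finset (Finset ι) :=
    {M ∈ I.powerset | #M < k ∧ (M : Set ι).PairwiseDisjoint A} with h𝓜
  set R : Finset ι → Finset ι := fun M => {i ∈ I | Disjoint (A i) (M.biUnion A)} with hR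
  have h1 : subsetPr U p (fun N => ¬ HasPacking I A k N) ≤
      ∑ M ∈ 𝓜, subsetPr U p (fun N => M.biUnion A ⊆ N ∧ ∀ i ∈ R M, ¬ A i ⊆ N) := by
    refine le_trans (subsetPr_mono hp0.le hp1 fun N _ hN => ?_)
      (subsetPr_exists_le hp0.le hp1 𝓜 _)
    obtain ⟨M, hM, hMk, hMd, hMN, hmax⟩ := exists_maximal_packing hN
    refine ⟨M, mem_filter.2 ⟨hM, hMk, hMd⟩, hMN, fun i hi => ?_⟩
    have hi' := mem_filter.1 hi
    refine hmax i hi'.1 hi'.2 fun hiM => ?_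
    have hne : (A i).Nonempty := card_pos.1 (by rw [hr i hi'.1]; omega)
    obtain ⟨x, hx⟩ := hne
    exact Finset.disjoint_left.1 hi'.2 hx (subset_biUnion_of_mem A hiM hx)
  -- few members meet a packing of size less than `k`
  have hmeet : ∀ j ∈ I, s * p ^ r * #{i ∈ I | ¬ Disjoint (A j) (A i)} ≤ 3 / 2 := by
    intro j hj
    have h2 : p ^ r * #{i ∈ I | ¬ Disjoint (A j) (A i)} ≤
        ∑ i ∈ I with ¬ Disjoint (A j) (A i), p ^ #(A i \ A j) := by
      rw [mul_comm, ← nsmul_eq_mul, ← sum_const]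
      refine sum_le_sum fun i hi => pow_le_pow_of_le_one hp0.le hp1 ?_
      rw [← hr i (mem_filter.1 hi).1]
      exact card_le_card sdiff_subset
    have h3 : ∑ i ∈ I with ¬ Disjoint (A j) (A i), p ^ #(A i \ A j) ≤
        ∑ i ∈ I with i ≠ j ∧ ¬ Disjoint (A j) (A i), p ^ #(A i \ A j) + 1 := by
      have h4 : ({i ∈ I | ¬ Disjoint (A j) (A i)} : Finset ι) ⊆
          insert j {i ∈ I | i ≠ j ∧ ¬ Disjoint (A j) (A i)} := by
        intro i hi
        rw [mem_filter] at hi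
        rw [mem_insert, mem_filter]
        by_cases h : i = j
        · exact Or.inl h
        · exact Or.inr ⟨hi.1, h, hi.2⟩
      refine (sum_le_sum_of_subset_of_nonneg h4 fun _ _ _ => by positivity).trans ?_
      rw [sum_insert (by simp)]
      simp [add_comm]
    have h4 := hI j hj
    have h5 := h2.trans h3
    nlinarith
  have hRM : ∀ M ∈ 𝓜, (#I : ℝ) / 2 ≤ #(R M) := by
    intro M hM
    obtain ⟨hMI, hMk, -⟩ := mem_filter.1 hM
    have h2 : #I ≤ #(R M) + ∑ j ∈ M, #{i ∈ I | ¬ Disjoint (A j) (A i)} := by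
      refine le_trans (card_le_card ?_) ((card_union_le _ _).trans
        (Nat.add_le_add_left card_biUnion_le _))
      intro i hi
      by_cases h : Disjoint (A i) (M.biUnion A)
      · exact mem_union_left _ (mem_filter.2 ⟨hi, h⟩)
      · refine mem_union_right _ ?_
        rw [disjoint_biUnion_right] at h
        push Not at h
        obtain ⟨j, hj, hd⟩ := h
        exact mem_biUnion.2 ⟨j, hj, mem_filter.2 ⟨hi, fun h' => hd h'.symm⟩⟩
    have h3 : (#I : ℝ) ≤ #(R M) + ∑ j ∈ M, (#{i ∈ I | ¬ Disjoint (A j) (A i)} : ℝ) := by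
      exact_mod_cast h2
    have h4 : s * p ^ r * ∑ j ∈ M, (#{i ∈ I | ¬ Disjoint (A j) (A i)} : ℝ) ≤ #M * (3 / 2) := by
      rw [mul_sum, ← nsmul_eq_mul, ← sum_const]
      exact sum_le_sum fun j hj => hmeet j (mem_powerset.1 hMI hj)
    have h5 : (#M : ℝ) ≤ k := by exact_mod_cast hMk.le
    have h6 : s * p ^ r * ∑ j ∈ M, (#{i ∈ I | ¬ Disjoint (A j) (A i)} : ℝ)
        ≤ s * p ^ r * (#I / 2) := by
      refine h4.trans ?_
      have : s ^ 2 * (p ^ r * #I) ≤ s * (p ^ r * #I) :=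
        mul_le_mul_of_nonneg_right (by nlinarith) hμ0
      nlinarith
    have h7 := le_of_mul_le_mul_left h6 (by positivity)
    linarith
  have h2 : ∀ M ∈ 𝓜, subsetPr U p (fun N => M.biUnion A ⊆ N ∧ ∀ i ∈ R M, ¬ A i ⊆ N)
      ≤ (p ^ r) ^ #M * Real.exp (-s * μ / 8) := by
    intro M hM
    obtain ⟨hMI, hMk, hMd⟩ := mem_filter.1 hM
    rw [mem_powerset] at hMI
    have hcard : #(M.biUnion A) = r * #M := by
      rw [card_biUnion hMd, sum_congr rfl fun i hi => hr i (hMI hi), sum_const, smul_eq_mul,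
        mul_comm]
    rw [← pow_mul, ← hcard]
    refine (subsetPr_superset_and_le (biUnion_subset.2 fun i hi => hA i (hMI hi)) hp0.le hp1
      fun N N' h h' i hi h'' => h' i hi (h''.trans h)).trans ?_
    refine mul_le_mul_of_nonneg_left ?_ (by positivity)
    have h3 : subsetPr U p (fun N => ∀ i ∈ R M, ¬ A i ⊆ N) ≤
        subsetEx U p (fun N => Real.exp (-s * #{i ∈ R M | A i ⊆ N})) := by
      refine subsetPr_le_subsetEx hp0.le hp1 (fun N _ => (Real.exp_pos _).le) fun N _ h => ?_
      rw [filter_eq_empty_iff.2 fun i hi => h i hi]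
      simp
    have hRI : R M ⊆ I := filter_subset _ _
    refine h3.trans ((subsetEx_exp_neg_le hp0.le hp1 (R M) A (fun i hi => hA i (hRI hi)) r
      (fun i hi => hr i (hRI hi)) hs0.le hs1 fun i hi => ?_).trans ?_)
    · refine le_trans (mul_le_mul_of_nonneg_left ?_ hs0.le) (hI i (hRI hi))
      exact sum_le_sum_of_subset_of_nonneg (filter_subset_filter _ hRI) fun _ _ _ => by positivity
    · refine Real.exp_le_exp.2 ?_
      have := mul_le_mul_of_nonneg_left (hRM M hM) (mul_pos hs0 hpr).le
      rw [hμ]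
      linarith
  set θ : ℝ := s / 16 with hθ
  have hθ0 : 0 < θ := by positivity
  have hθ1 : θ ≤ 1 := by rw [hθ]; linarith
  have h3 : ∑ M ∈ 𝓜, (p ^ r) ^ #M ≤ (θ⁻¹) ^ k * Real.exp (θ * μ) := by
    calc ∑ M ∈ 𝓜, (p ^ r) ^ #M ≤ ∑ M ∈ 𝓜, (θ⁻¹) ^ k * (θ * p ^ r) ^ #M := by
          refine sum_le_sum fun M hM => ?_
          have hMk := (mem_filter.1 hM).2.1
          rw [mul_pow, ← mul_assoc]
          refine le_mul_of_one_le_left (by positivity) ?_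
          calc (1 : ℝ) = (θ⁻¹) ^ #M * θ ^ #M := by rw [← mul_pow, inv_mul_cancel₀ hθ0.ne', one_pow]
            _ ≤ (θ⁻¹) ^ k * θ ^ #M := by
              refine mul_le_mul_of_nonneg_right ?_ (by positivity)
              exact pow_le_pow_right₀ (one_le_inv_iff₀.2 ⟨hθ0, hθ1⟩) hMk.le
      _ ≤ ∑ M ∈ I.powerset, (θ⁻¹) ^ k * (θ * p ^ r) ^ #M :=
          sum_le_sum_of_subset_of_nonneg (filter_subset _ _) fun _ _ _ => by positivity
      _ = (θ⁻¹) ^ k * (θ * p ^ r + 1) ^ #I := by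
          rw [← mul_sum, ← Finset.sum_pow_mul_eq_add_pow]
          simp
      _ ≤ (θ⁻¹) ^ k * Real.exp (θ * μ) := by
          refine mul_le_mul_of_nonneg_left ?_ (by positivity)
          calc (θ * p ^ r + 1) ^ #I ≤ (Real.exp (θ * p ^ r)) ^ #I := by
                gcongr
                exact Real.add_one_le_exp _
            _ = Real.exp (θ * μ) := by
                rw [← Real.exp_nat_mul, hμ]
                ring_nf
  have h4 : (θ⁻¹) ^ k ≤ Real.exp (s * μ / 32) := by
    calc (θ⁻¹) ^ k ≤ (Real.exp (θ⁻¹)) ^ k := by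
          gcongr
          linarith [Real.add_one_le_exp (θ⁻¹)]
      _ = Real.exp (k * θ⁻¹) := by rw [← Real.exp_nat_mul]
      _ ≤ Real.exp (s * μ / 32) := by
          refine Real.exp_le_exp.2 ?_
          rw [hθ, inv_div, ← mul_div_assoc, div_le_iff₀ hs0]
          nlinarith
  calc subsetPr U p (fun N => ¬ HasPacking I A k N)
      ≤ ∑ M ∈ 𝓜, (p ^ r) ^ #M * Real.exp (-s * μ / 8) := h1.trans (sum_le_sum h2)
    _ ≤ ((θ⁻¹) ^ k * Real.exp (θ * μ)) * Real.exp (-s * μ / 8) := by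
        rw [← sum_mul]
        exact mul_le_mul_of_nonneg_right h3 (Real.exp_pos _).le
    _ ≤ (Real.exp (s * μ / 32) * Real.exp (θ * μ)) * Real.exp (-s * μ / 8) := by
        gcongr
    _ = Real.exp (-s * μ / 32) := by
        rw [← Real.exp_add, ← Real.exp_add, hθ]
        ring_nf

end Packing

/-! ### Choosing paths of length two -/

section Cherries

variable {V : Type*} [Fintype V] [LinearOrder V]

/-- The neighbours of `u` in the graph with edge set `P`. -/
def edgeNbrs (P : Finset (Sym2 V)) (u : V) : Finset V := {x | s(x, u) ∈ P}

/-- `c = (u, x, y)` is a path `x u y` in the graph with edge set `P`. The path is counted once, as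
the leaves are ordered by `x < y`. -/
def IsCherry (P : Finset (Sym2 V)) (c : V × V × V) : Prop :=
  c.2.1 < c.2.2 ∧ s(c.2.1, c.1) ∈ P ∧ s(c.2.2, c.1) ∈ P

/-- The members of `𝒞` which have the leaf `z`. -/
def cherriesAt (𝒞 : Finset (V × V × V)) (z : V) : Finset (V × V × V) :=
  {c ∈ 𝒞 | c.2.1 = z ∨ c.2.2 = z}

lemma mem_edgeNbrs {P : Finset (Sym2 V)} {u x : V} : x ∈ edgeNbrs P u ↔ s(x, u) ∈ P := by
  simp [edgeNbrs]

lemma card_sigma_edgeNbrs_le (P : Finset (Sym2 V)) :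
    ∑ u, #(edgeNbrs P u) ≤ 2 * #P := by
  rw [← card_sigma]
  refine card_le_mul_card_image_of_maps_to (f := fun q : (_ : V) × V => s(q.2, q.1)) ?_ 2 ?_
  · rintro ⟨u, x⟩ h
    simpa [mem_edgeNbrs] using h
  · intro e _
    induction e using Sym2.ind with
    | _ a b =>
      refine le_trans (card_le_card (t := {⟨a, b⟩, ⟨b, a⟩}) ?_) card_le_two
      rintro ⟨u, x⟩ h
      rw [mem_filter] at h
      have := Sym2.eq_iff.1 h.2
      simp only [mem_insert, mem_singleton, Sigma.mk.injEq, heq_eq_eq]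
      tauto

lemma card_le_sum_edgeNbrs_inter (P : Finset (Sym2 V)) (L : Finset V) :
    #P ≤ ∑ u, #(edgeNbrs P u ∩ L) + #(Lᶜ.sym2 ∩ P) := by
  rw [← card_sigma]
  refine le_trans (card_le_card (t := (univ.sigma fun u => edgeNbrs P u ∩ L).image
    (fun q : (_ : V) × V => s(q.2, q.1)) ∪ (Lᶜ.sym2 ∩ P)) ?_)
    ((card_union_le _ _).trans (Nat.add_le_add_right card_image_le _))
  intro e he
  induction e using Sym2.ind with
  | _ a b =>
    rw [mem_union]
    by_cases h : s(a, b) ∈ Lᶜ.sym2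
    · exact Or.inr (mem_inter.2 ⟨h, he⟩)
    · left
      rw [mem_image]
      rw [mk_mem_sym2_iff, mem_compl, mem_compl, not_and_or, not_not, not_not] at h
      rcases h with h | h
      · exact ⟨⟨b, a⟩, by simp [mem_edgeNbrs, he, h], rfl⟩
      · exact ⟨⟨a, b⟩, by simp [mem_edgeNbrs, Sym2.eq_swap, he, h], Sym2.eq_swap⟩

omit [Fintype V] in
lemma two_mul_card_offDiag_filter_lt (A : Finset V) :
    2 * #{q ∈ A.offDiag | q.1 < q.2} = #A * #A - #A := by
  rw [← offDiag_card, ← card_filter_add_card_filter_not (s := A.offDiag) fun q => q.1 < q.2,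
    two_mul]
  congr 1
  refine card_nbij' Prod.swap Prod.swap ?_ ?_ (fun _ _ => rfl) (fun _ _ => rfl)
  · rintro ⟨x, y⟩ h
    simp only [mem_coe, mem_filter, mem_offDiag, Prod.fst_swap, Prod.snd_swap] at h ⊢
    exact ⟨⟨h.1.2.1, h.1.1, h.1.2.2.symm⟩, not_lt.2 h.2.le⟩
  · rintro ⟨x, y⟩ h
    simp only [mem_coe, mem_filter, mem_offDiag, Prod.fst_swap, Prod.snd_swap] at h ⊢
    exact ⟨⟨h.1.2.1, h.1.1, h.1.2.2.symm⟩, lt_of_le_of_ne (not_lt.1 h.2) h.1.2.2.symm⟩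

/-- The number of cherries is at least its value for a regular graph, by convexity. -/
lemma sq_le_card_cherries (A : V → Finset V) (a : ℝ) (ha : (Fintype.card V : ℝ) ≤ a)
    (hA : a ≤ ∑ u, (#(A u) : ℝ)) (𝒞 : Finset (V × V × V))
    (h𝒞 : ∀ u, ∀ x ∈ A u, ∀ y ∈ A u, x < y → (u, x, y) ∈ 𝒞) :
    a * (a - Fintype.card V) ≤ 2 * Fintype.card V * #𝒞 := by
  set n : ℝ := (Fintype.card V : ℝ) with hn
  have h1 : ∑ u, #{q ∈ (A u).offDiag | q.1 < q.2} ≤ #𝒞 := by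
    rw [← card_sigma]
    refine card_le_card_of_injOn (fun q : (_ : V) × (V × V) => (q.1, q.2.1, q.2.2)) ?_ ?_
    · rintro ⟨u, x, y⟩ h
      simp only [mem_coe, mem_sigma, mem_univ, true_and, mem_filter, mem_offDiag] at h
      exact h𝒞 u x h.1.1 y h.1.2.1 h.2
    · rintro ⟨u, x, y⟩ - ⟨u', x', y'⟩ - h
      simp only [Prod.mk.injEq] at h
      obtain ⟨rfl, rfl, rfl⟩ := h
      rfl
  have h2 : ∑ u, ((#(A u) : ℝ) ^ 2 - #(A u)) ≤ 2 * #𝒞 := by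
    calc ∑ u, ((#(A u) : ℝ) ^ 2 - #(A u))
        = ∑ u, (2 * #{q ∈ (A u).offDiag | q.1 < q.2} : ℝ) := by
          refine sum_congr rfl fun u _ => ?_
          have h3 := two_mul_card_offDiag_filter_lt (A u)
          have h4 : ((2 * #{q ∈ (A u).offDiag | q.1 < q.2} : ℕ) : ℝ)
              = ((#(A u) * #(A u) - #(A u) : ℕ) : ℝ) := by rw [h3]
          rw [Nat.cast_sub (Nat.le_mul_self _)] at h4
          push_cast at h4
          rw [h4]
          ring
      _ ≤ 2 * #𝒞 := by
          rw [← mul_sum]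
          have : (∑ u, (#{q ∈ (A u).offDiag | q.1 < q.2} : ℝ)) ≤ #𝒞 := by exact_mod_cast h1
          linarith
  rw [sum_sub_distrib] at h2
  have h3 := sq_sum_le_card_mul_sum_sq (s := (univ : Finset V)) (f := fun u => (#(A u) : ℝ))
  rw [card_univ, ← hn] at h3
  set S : ℝ := ∑ u, (#(A u) : ℝ)
  set Q : ℝ := ∑ u, (#(A u) : ℝ) ^ 2
  have hn0 : 0 ≤ n := by positivity
  have h4 : S * (S - n) ≤ 2 * n * #𝒞 := by nlinarith
  refine le_trans ?_ h4
  exact mul_le_mul hA (by linarith) (by linarith) (by linarith)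

/-- A graph with `m` edges in which vertices of degree more than `d` span at most half of the edges
has `m ^ 2 / (64 n)` cherries such that no vertex is a leaf of more than `D ≥ m d / (8 n)` of them.
In a maximal family of cherries subject to the constraint on the leaves, few vertices are
saturated, and all cherries whose leaves are unsaturated belong to the family. -/
lemma exists_cherries [Nonempty V] (P : Finset (Sym2 V)) {d : ℝ} (hd : 0 < d)
    (hX : ∀ X : Finset V, d * #X ≤ 2 * #P → 2 * #(X.sym2 ∩ P) ≤ #P)
    {D : ℕ} (hD0 : 0 < D) (hD : #P * d ≤ 8 * Fintype.card V * D)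
    (hm : 8 * Fintype.card V ≤ #P) :
    ∃ 𝒞 : Finset (V × V × V), #𝒞 = ⌈(#P : ℝ) ^ 2 / (64 * Fintype.card V)⌉₊ ∧
      (∀ c ∈ 𝒞, IsCherry P c) ∧ ∀ z, #(cherriesAt 𝒞 z) ≤ D := by
  classical
  set n : ℝ := (Fintype.card V : ℝ) with hn
  set m : ℝ := (#P : ℝ) with hmdef
  have hn0 : 0 < n := by
    have := Fintype.card_pos (α := V)
    rw [hn]
    exact_mod_cast this
  have hm' : 8 * n ≤ m := by rw [hn, hmdef]; exact_mod_cast hm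
  have hm0 : 0 < m := by linarith
  suffices h : ∃ 𝒞 : Finset (V × V × V), m ^ 2 / (64 * n) ≤ #𝒞 ∧
      (∀ c ∈ 𝒞, IsCherry P c) ∧ ∀ z, #(cherriesAt 𝒞 z) ≤ D by
    obtain ⟨𝒞, h1, h2, h3⟩ := h
    obtain ⟨𝒞', hsub, hcard⟩ := exists_subset_card_eq (Nat.ceil_le.2 h1)
    exact ⟨𝒞', hcard, fun c hc => h2 c (hsub hc),
      fun z => (card_le_card (filter_subset_filter _ hsub)).trans (h3 z)⟩
  set 𝓕 : Finset (Finset (V × V × V)) :=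
    {𝒞 | (∀ c ∈ 𝒞, IsCherry P c) ∧ ∀ z, #(cherriesAt 𝒞 z) ≤ D} with h𝓕
  obtain ⟨𝒞, h𝒞, hmax⟩ := exists_max_image 𝓕 card ⟨∅, by simp [h𝓕, cherriesAt]⟩
  obtain ⟨-, h𝒞P, h𝒞D⟩ := mem_filter.1 h𝒞
  refine ⟨𝒞, ?_, h𝒞P, h𝒞D⟩
  by_contra! hlt
  set L : Finset V := {x | (#(edgeNbrs P x) : ℝ) ≤ d} with hL
  set S : Finset V := {z | D ≤ #(cherriesAt 𝒞 z)} with hS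
  have hsum : ∑ u, (#(edgeNbrs P u) : ℝ) ≤ 2 * m := by
    have := card_sigma_edgeNbrs_le P
    rw [hmdef]
    exact_mod_cast this
  have hLc : d * #Lᶜ ≤ 2 * m := by
    refine le_trans ?_ hsum
    rw [mul_comm, ← nsmul_eq_mul, ← sum_const]
    refine (sum_le_sum fun x hx => ?_).trans
      (sum_le_sum_of_subset_of_nonneg (subset_univ Lᶜ) fun _ _ _ => by positivity)
    simp only [hL, mem_compl, mem_filter, mem_univ, true_and, not_le] at hx
    exact hx.le
  have hSD : (D : ℝ) * #S ≤ 2 * #𝒞 := by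
    have h1 : D * #S ≤ ∑ z, #(cherriesAt 𝒞 z) := by
      rw [mul_comm, ← smul_eq_mul, ← sum_const]
      refine (sum_le_sum fun z hz => (mem_filter.1 hz).2).trans
        (sum_le_sum_of_subset (subset_univ S))
    have h2 : ∑ z, #(cherriesAt 𝒞 z) ≤ 2 * #𝒞 := by
      simp only [cherriesAt, card_filter]
      rw [sum_comm, mul_comm, ← smul_eq_mul, ← sum_const]
      refine sum_le_sum fun c _ => ?_
      rw [← card_filter]
      refine le_trans (card_le_card (t := {c.2.1, c.2.2}) fun z hz => ?_) card_le_two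
      rw [mem_filter] at hz
      simp only [mem_insert, mem_singleton]
      exact hz.2.imp Eq.symm Eq.symm
    exact_mod_cast h1.trans h2
  -- unsaturated leaves of small degree still see a quarter of the edges
  have hquarter : m / 4 ≤ ∑ u, (#(edgeNbrs P u ∩ (L \ S)) : ℝ) := by
    have h1 : m ≤ ∑ u, (#(edgeNbrs P u ∩ L) : ℝ) + #(Lᶜ.sym2 ∩ P) := by
      rw [hmdef]
      exact_mod_cast card_le_sum_edgeNbrs_inter P L
    have h2 : 2 * (#(Lᶜ.sym2 ∩ P) : ℝ) ≤ m := by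
      rw [hmdef]
      exact_mod_cast hX Lᶜ hLc
    have h3 : ∑ u, (#(edgeNbrs P u ∩ L) : ℝ)
        ≤ ∑ u, (#(edgeNbrs P u ∩ (L \ S)) : ℝ) + ∑ u, (#(edgeNbrs P u ∩ (L ∩ S)) : ℝ) := by
      rw [← sum_add_distrib]
      refine sum_le_sum fun u _ => ?_
      have : edgeNbrs P u ∩ L ⊆ edgeNbrs P u ∩ (L \ S) ∪ edgeNbrs P u ∩ (L ∩ S) := by
        rw [← inter_union_distrib_left, sdiff_union_inter]
      exact_mod_cast (card_le_card this).trans (card_union_le _ _)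
    have h4 : ∑ u, (#(edgeNbrs P u ∩ (L ∩ S)) : ℝ) ≤ #S * d := by
      have h5 : ∑ u, #(edgeNbrs P u ∩ (L ∩ S)) = ∑ x ∈ L ∩ S, #(edgeNbrs P x) := by
        have h6 := sum_card_bipartiteAbove_eq_sum_card_bipartiteBelow
          (s := (univ : Finset V)) (t := L ∩ S) (fun u x => s(x, u) ∈ P)
        have h7 : ∀ u, edgeNbrs P u ∩ (L ∩ S) = (L ∩ S).bipartiteAbove (fun u x => s(x, u) ∈ P) u :=
          fun u => by ext x; simp [edgeNbrs, bipartiteAbove, and_comm]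
        have h8 : ∀ x, edgeNbrs P x = (univ : Finset V).bipartiteBelow (fun u x => s(x, u) ∈ P) x :=
          fun x => by ext u; simp [edgeNbrs, bipartiteBelow, Sym2.eq_swap]
        simp only [h7]
        rw [h6]
        exact sum_congr rfl fun x _ => by rw [h8]
      have h6 : ∑ x ∈ L ∩ S, (#(edgeNbrs P x) : ℝ) ≤ #(L ∩ S) * d := by
        rw [← nsmul_eq_mul, ← sum_const]
        exact sum_le_sum fun x hx => (mem_filter.1 (mem_inter.1 hx).1).2
      have h7 : (#(L ∩ S) : ℝ) ≤ #S := by exact_mod_cast card_le_card inter_subset_right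
      have h8 : ∑ u, (#(edgeNbrs P u ∩ (L ∩ S)) : ℝ) = ∑ x ∈ L ∩ S, (#(edgeNbrs P x) : ℝ) := by
        exact_mod_cast h5
      rw [h8]
      nlinarith
    have h5 : #S * d ≤ m / 4 := by
      have hD0' : (0 : ℝ) < D := by exact_mod_cast hD0
      have h6 : 2 * (#𝒞 : ℝ) ≤ m ^ 2 / (32 * n) := by
        have : m ^ 2 / (64 * n) = m ^ 2 / (32 * n) / 2 := by field_simp; norm_num
        linarith
      have h7 : (D : ℝ) * #S * (32 * n) ≤ m ^ 2 := by
        rw [← le_div_iff₀ (by positivity)]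
        linarith
      have h8 : m * (#S * d) ≤ #S * (8 * n * D) := by
        have : (0 : ℝ) ≤ #S := by positivity
        nlinarith
      have h9 : m * (#S * d) ≤ m * (m / 4) := by nlinarith
      exact le_of_mul_le_mul_left h9 hm0
    linarith
  -- all cherries with unsaturated leaves of small degree belong to the maximal family
  have hall : ∀ u, ∀ x ∈ edgeNbrs P u ∩ (L \ S), ∀ y ∈ edgeNbrs P u ∩ (L \ S), x < y →
      (u, x, y) ∈ 𝒞 := by
    intro u x hx y hy hxy
    by_contra hnot
    simp only [mem_inter, mem_edgeNbrs, mem_sdiff, hS, mem_filter, mem_univ, true_and,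
      not_le] at hx hy
    have hmem : insert (u, x, y) 𝒞 ∈ 𝓕 := by
      rw [h𝓕, mem_filter]
      refine ⟨mem_univ _, ?_, ?_⟩
      · intro c hc
        rcases mem_insert.1 hc with rfl | hc
        · exact ⟨hxy, hx.1, hy.1⟩
        · exact h𝒞P c hc
      · intro z
        unfold cherriesAt
        rw [filter_insert]
        split_ifs with h
        · refine (card_insert_le _ _).trans ?_
          rcases h with rfl | rfl
          · exact hx.2.2
          · exact hy.2.2
        · exact h𝒞D z
    have := hmax _ hmem
    rw [card_insert_of_notMem hnot] at this
    omega
  have hfin := sq_le_card_cherries (fun u => edgeNbrs P u ∩ (L \ S)) (m / 4) (by linarith)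
    hquarter 𝒞 hall
  rw [← hn] at hfin
  rw [lt_div_iff₀ (by positivity)] at hlt
  nlinarith

end Cherries

/-! ### Completing paths of length two to four-cycles -/

section Closings

variable {V : Type*} [Fintype V] [LinearOrder V]

/-- The pairs of distinct vertices, that is, the edges of the complete graph. -/
def vertexPairs (V : Type*) [Fintype V] [DecidableEq V] : Finset (Sym2 V) := {e | ¬ e.IsDiag}

/-- For `q = ((u, x, y), v)`, the two edges at `v` which complete the path `x u y` to the
`4`-cycle `x u y v`. -/
def closing (q : (V × V × V) × V) : Finset (Sym2 V) := {s(q.1.2.1, q.2), s(q.1.2.2, q.2)}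

/-- All ways to complete members of `𝒞` to `4`-cycles by two edges outside `W`. -/
def closings (𝒞 : Finset (V × V × V)) (W : Finset (Sym2 V)) : Finset ((V × V × V) × V) :=
  {q ∈ 𝒞 ×ˢ univ | q.2 ≠ q.1.2.1 ∧ q.2 ≠ q.1.2.2 ∧ Disjoint (closing q) W}

/-- The properties of a typical random graph which are used: no vertex sees more than an eighth of
all vertices, all vertex sets `X` span at most `2 p |X| ^ 2 + 2 n` edges, and pairs of vertices
have at most `κ` common neighbours. All of them are inherited by subgraphs. -/
structure IsTypical (p : ℝ) (κ : ℕ) (N : Finset (Sym2 V)) : Prop where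
  degree_le : ∀ x, 8 * #(edgeNbrs N x) ≤ Fintype.card V
  card_sym2_inter_le : ∀ X : Finset V,
    (#(X.sym2 ∩ N) : ℝ) ≤ 2 * p * (#X : ℝ) ^ 2 + 2 * Fintype.card V
  codegree_le : ∀ x y, x < y → #{u | s(x, u) ∈ N ∧ s(y, u) ∈ N} ≤ κ

lemma IsTypical.anti {p : ℝ} {κ : ℕ} {N N' : Finset (Sym2 V)} (hN : IsTypical p κ N)
    (h : N' ⊆ N) : IsTypical p κ N' where
  degree_le x := by
    have : #(edgeNbrs N' x) ≤ #(edgeNbrs N x) :=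
      card_le_card fun y hy => mem_edgeNbrs.2 (h (mem_edgeNbrs.1 hy))
    have := hN.degree_le x
    omega
  card_sym2_inter_le X := by
    refine le_trans ?_ (hN.card_sym2_inter_le X)
    exact_mod_cast card_le_card (inter_subset_inter_left h)
  codegree_le x y hxy := by
    refine (card_le_card fun u hu => ?_).trans (hN.codegree_le x y hxy)
    simp only [mem_filter, mem_univ, true_and] at hu ⊢
    exact hu.imp (@h _) (@h _)

omit [Fintype V] in
/-- A pair of edges meeting in a vertex determines this vertex and the two others. -/
lemma closing_injective {x y u x' y' u' : V} (hxy : x < y) (hxy' : x' < y')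
    (hux : u ≠ x) (huy : u ≠ y)
    (h : ∀ e : Sym2 V, (e = s(x, u) ∨ e = s(y, u)) ↔ (e = s(x', u') ∨ e = s(y', u'))) :
    x = x' ∧ y = y' ∧ u = u' := by
  have h1 := (h s(x, u)).1 (Or.inl rfl)
  have h2 := (h s(y, u)).1 (Or.inr rfl)
  have h3 := (h s(x', u')).2 (Or.inl rfl)
  have h4 := (h s(y', u')).2 (Or.inr rfl)
  simp only [Sym2.eq_iff] at h1 h2 h3 h4
  have := hxy.ne
  have := hxy'.ne
  have := hxy.asymm
  have := hxy'.asymm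
  grind

omit [Fintype V] in
lemma card_closing {q : (V × V × V) × V} (h : q.1.2.1 < q.1.2.2) : #(closing q) = 2 := by
  refine card_pair fun h' => ?_
  rw [Sym2.eq_iff] at h'
  have := h.ne
  grind

lemma closing_subset_vertexPairs {𝒞 : Finset (V × V × V)} {W : Finset (Sym2 V)}
    {q : (V × V × V) × V} (hq : q ∈ closings 𝒞 W) : closing q ⊆ vertexPairs V := by
  have h := (mem_filter.1 hq).2
  intro e he
  simp only [closing, mem_insert, mem_singleton] at he
  simp only [vertexPairs, mem_filter, mem_univ, true_and]
  rcases he with rfl | rfl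
  · simpa using h.1.symm
  · simpa using h.2.1.symm

lemma card_closings_le (𝒞 : Finset (V × V × V)) (W : Finset (Sym2 V)) :
    #(closings 𝒞 W) ≤ #𝒞 * Fintype.card V := by
  refine (card_filter_le _ _).trans ?_
  rw [card_product, card_univ]

lemma le_card_closings (𝒞 : Finset (V × V × V)) {W : Finset (Sym2 V)}
    (hW : ∀ x, 8 * #(edgeNbrs W x) ≤ Fintype.card V) (hn : 8 ≤ Fintype.card V) :
    #𝒞 * Fintype.card V ≤ 2 * #(closings 𝒞 W) := by
  have h1 : ∀ c ∈ 𝒞, Fintype.card V ≤ 2 * #{v | v ≠ c.2.1 ∧ v ≠ c.2.2 ∧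
      Disjoint (closing (c, v)) W} := by
    intro c _
    have h2 : (univ : Finset V) ⊆
        univ.filter (fun v => v ≠ c.2.1 ∧ v ≠ c.2.2 ∧ Disjoint (closing (c, v)) W) ∪
        ({c.2.1, c.2.2} ∪ (edgeNbrs W c.2.1 ∪ edgeNbrs W c.2.2)) := by
      intro v _
      simp only [mem_union, mem_filter, mem_univ, true_and, mem_insert, mem_singleton,
        mem_edgeNbrs, closing, disjoint_insert_left, disjoint_singleton_left]
      rw [Sym2.eq_swap (a := v) (b := c.2.1), Sym2.eq_swap (a := v) (b := c.2.2)]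
      tauto
    have h3 := card_le_card h2
    have h4 := card_union_le {v | v ≠ c.2.1 ∧ v ≠ c.2.2 ∧ Disjoint (closing (c, v)) W}
      ({c.2.1, c.2.2} ∪ (edgeNbrs W c.2.1 ∪ edgeNbrs W c.2.2))
    have h5 := card_union_le {c.2.1, c.2.2} (edgeNbrs W c.2.1 ∪ edgeNbrs W c.2.2)
    have h6 := card_union_le (edgeNbrs W c.2.1) (edgeNbrs W c.2.2)
    have h7 : #({c.2.1, c.2.2} : Finset V) ≤ 2 := card_le_two
    have h8 := hW c.2.1
    have h9 := hW c.2.2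
    rw [card_univ] at h3
    omega
  have h2 : #(closings 𝒞 W) = ∑ c ∈ 𝒞, #{v | v ≠ c.2.1 ∧ v ≠ c.2.2 ∧
      Disjoint (closing (c, v)) W} := by
    simp only [closings, card_filter]
    rw [sum_product]
  rw [h2, mul_sum, ← smul_eq_mul, ← sum_const]
  exact sum_le_sum h1

lemma card_closings_mem_le {𝒞 : Finset (V × V × V)} (W : Finset (Sym2 V)) {D : ℕ}
    (hD : ∀ z, #(cherriesAt 𝒞 z) ≤ D) (e : Sym2 V) :
    #{q ∈ closings 𝒞 W | e ∈ closing q} ≤ 2 * D := by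
  classical
  induction e using Sym2.ind with
  | _ a b =>
    have h : ({q ∈ closings 𝒞 W | s(a, b) ∈ closing q} : Finset _) ⊆
        (cherriesAt 𝒞 a).image (fun c => (c, b)) ∪ (cherriesAt 𝒞 b).image (fun c => (c, a)) := by
      rintro ⟨c, v⟩ hq
      obtain ⟨hq, h1⟩ := mem_filter.1 hq
      have h2 := (mem_product.1 (mem_filter.1 hq).1).1
      simp only [mem_union, mem_image, cherriesAt, mem_filter, Prod.mk.injEq]
      simp only [closing, mem_insert, mem_singleton, Sym2.eq_iff] at h1 h2
      grind
    refine (card_le_card h).trans ((card_union_le _ _).trans ?_)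
    have h1 := (card_image_le (s := cherriesAt 𝒞 a) (f := fun c => (c, b))).trans (hD a)
    have h2 := (card_image_le (s := cherriesAt 𝒞 b) (f := fun c => (c, a))).trans (hD b)
    omega

/-- The correlation term of the closings: at most `κ` of them coincide with a given one, and those
which share one edge with it contribute one factor of `p`. -/
lemma sum_closings_le {P W : Finset (Sym2 V)} {𝒞 : Finset (V × V × V)} {p : ℝ} (hp0 : 0 ≤ p)
    (hp1 : p ≤ 1) {κ D : ℕ} (h𝒞 : ∀ c ∈ 𝒞, IsCherry P c) (hD : ∀ z, #(cherriesAt 𝒞 z) ≤ D)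
    (hκ : ∀ x y, x < y → #{u | s(x, u) ∈ P ∧ s(y, u) ∈ P} ≤ κ)
    {i : (V × V × V) × V} (hi : i ∈ closings 𝒞 W) :
    ∑ j ∈ closings 𝒞 W with j ≠ i ∧ ¬ Disjoint (closing i) (closing j),
      p ^ #(closing j \ closing i) ≤ κ + 4 * D * p := by
  classical
  have hlt : ∀ j ∈ closings 𝒞 W, j.1.2.1 < j.1.2.2 := fun j hj =>
    (h𝒞 j.1 (mem_product.1 (mem_filter.1 hj).1).1).1
  set S := {j ∈ closings 𝒞 W | closing j = closing i} with hS
  set T := {j ∈ closings 𝒞 W | ¬ Disjoint (closing i) (closing j)} with hT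
  have hScard : #S ≤ κ := by
    refine le_trans ?_ (hκ i.1.2.1 i.1.2.2 (hlt i hi))
    have hdet : ∀ j ∈ S, i.1.2.1 = j.1.2.1 ∧ i.1.2.2 = j.1.2.2 ∧ i.2 = j.2 := by
      intro j hj
      obtain ⟨hj, hji⟩ := mem_filter.1 hj
      have hi' := (mem_filter.1 hi).2
      refine closing_injective (hlt i hi) (hlt j hj) hi'.1 hi'.2.1 fun e => ?_
      have := Finset.ext_iff.1 hji e
      simp only [closing, mem_insert, mem_singleton] at this
      exact this.symm
    refine card_le_card_of_injOn (fun j => j.1.1) ?_ ?_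
    · intro j hj
      have h1 := hdet j hj
      have h2 := (h𝒞 j.1 (mem_product.1 (mem_filter.1 (mem_filter.1 hj).1).1).1).2
      simp only [mem_coe, mem_filter, mem_univ, true_and, h1.1, h1.2.1]
      exact h2
    · rintro ⟨⟨u, x, y⟩, v⟩ hj ⟨⟨u', x', y'⟩, v'⟩ hj' h
      have h1 := hdet _ hj
      have h2 := hdet _ hj'
      grind
  have hTcard : #T ≤ 4 * D := by
    have h1 : T ⊆ (closing i).biUnion fun e => {q ∈ closings 𝒞 W | e ∈ closing q} := by
      intro j hj
      obtain ⟨hj, hd⟩ := mem_filter.1 hj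
      obtain ⟨e, he, he'⟩ := not_disjoint_iff.1 hd
      exact mem_biUnion.2 ⟨e, he, mem_filter.2 ⟨hj, he'⟩⟩
    refine (card_le_card h1).trans (card_biUnion_le.trans ?_)
    refine (sum_le_sum fun e _ => card_closings_mem_le W hD e).trans ?_
    rw [sum_const, card_closing (hlt i hi), smul_eq_mul]
    omega
  have h1 : ∀ j ∈ closings 𝒞 W, p ^ #(closing j \ closing i)
      ≤ (if closing j = closing i then 1 else 0) + p := by
    intro j hj
    split_ifs with h
    · rw [h, sdiff_self]
      simpa using hp0
    · rw [zero_add]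
      refine (pow_le_pow_of_le_one hp0 hp1 (m := 1) ?_).trans (pow_one p).le
      rw [Nat.one_le_iff_ne_zero, Ne, card_eq_zero, sdiff_eq_empty_iff_subset]
      refine fun h' => h (eq_of_subset_of_card_le h' ?_)
      rw [card_closing (hlt i hi), card_closing (hlt j hj)]
  calc ∑ j ∈ closings 𝒞 W with j ≠ i ∧ ¬ Disjoint (closing i) (closing j),
        p ^ #(closing j \ closing i)
      ≤ ∑ j ∈ T, p ^ #(closing j \ closing i) := by
        refine sum_le_sum_of_subset_of_nonneg (fun j hj => ?_) fun _ _ _ => by positivity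
        rw [mem_filter] at hj
        exact mem_filter.2 ⟨hj.1, hj.2.2⟩
    _ ≤ ∑ j ∈ T, ((if closing j = closing i then 1 else 0) + p) :=
        sum_le_sum fun j hj => h1 j (mem_filter.1 hj).1
    _ ≤ #S + #T * p := by
        rw [sum_add_distrib, sum_const, nsmul_eq_mul, ← sum_filter, sum_const, nsmul_eq_mul,
          mul_one]
        gcongr
        refine fun j hj => ?_
        rw [mem_filter] at hj
        exact mem_filter.2 ⟨(mem_filter.1 hj.1).1, hj.2⟩
    _ ≤ κ + 4 * D * p := by
        have h2 : (#S : ℝ) ≤ κ := by exact_mod_cast hScard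
        have h3 : (#T : ℝ) ≤ 4 * D := by exact_mod_cast hTcard
        nlinarith

/-- The family of closings on which the two probabilistic estimates are based: for a typical graph
`W` and a set `P` of `m` of its edges there are about `m ^ 2` ways to complete a path of length two
in `P` to a `4`-cycle by two pairs outside `W`, and they are weakly correlated. -/
lemma exists_closings {p : ℝ} (hp0 : 0 < p) (hp1 : p ≤ 1) {κ : ℕ} {P W : Finset (Sym2 V)}
    (hPW : P ⊆ W) (hW : IsTypical p κ W) (hn : 8 ≤ Fintype.card V)
    (hm : 16 * Fintype.card V ≤ #P) :
    ∃ I : Finset ((V × V × V) × V),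
      (∀ q ∈ I, IsCherry P q.1 ∧ q.2 ≠ q.1.2.1 ∧ q.2 ≠ q.1.2.2 ∧
        closing q ⊆ vertexPairs V ∧ Disjoint (closing q) W ∧ #(closing q) = 2) ∧
      (#P : ℝ) ^ 2 ≤ 128 * #I ∧ 32 * (#I : ℝ) ≤ (#P : ℝ) ^ 2 ∧
      ∀ i ∈ I, ∑ j ∈ I with j ≠ i ∧ ¬ Disjoint (closing i) (closing j),
        p ^ #(closing j \ closing i)
          ≤ κ + 3 * (p * #P * √(p * #P)) / Fintype.card V + 4 * p := by
  have : Nonempty V := Fintype.card_pos_iff.1 (by omega)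
  set n : ℝ := (Fintype.card V : ℝ) with hndef
  set m : ℝ := (#P : ℝ) with hmdef
  have hn8 : 8 ≤ n := by rw [hndef]; exact_mod_cast hn
  have hm' : 16 * n ≤ m := by rw [hndef, hmdef]; exact_mod_cast hm
  have hm0 : 0 < m := by linarith
  have hn0 : 0 < n := by linarith
  have hsq : √(p * m) ^ 2 = p * m := Real.sq_sqrt (by positivity)
  have hsqrt : 0 < √(p * m) := Real.sqrt_pos.2 (by positivity)
  set d : ℝ := 6 * √(p * m) with hd
  have hd0 : 0 < d := by positivity
  set D : ℕ := ⌈m * d / (8 * n)⌉₊ with hD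
  have hP := hW.anti hPW
  obtain ⟨𝒞, hcard, h𝒞, h𝒞D⟩ := exists_cherries P hd0 (fun X hX => by
      have h1 := hP.card_sym2_inter_le X
      have h2 : p * (#X : ℝ) ^ 2 ≤ m / 9 := by
        have h3 : (d * #X) ^ 2 ≤ (2 * m) ^ 2 := by gcongr
        have h4 : (d * #X) ^ 2 = 36 * m * (p * (#X : ℝ) ^ 2) := by
          rw [hd, mul_pow, mul_pow, hsq]; ring
        rw [h4] at h3
        have h5 : 36 * m * (p * (#X : ℝ) ^ 2) ≤ 36 * m * (m / 9) := by linarith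
        exact le_of_mul_le_mul_left h5 (by positivity)
      have h3 : 2 * (#(X.sym2 ∩ P) : ℝ) ≤ m := by linarith
      rw [hmdef] at h3
      exact_mod_cast h3) (D := D) (Nat.ceil_pos.2 (by positivity)) (by
      have := Nat.le_ceil (m * d / (8 * n))
      rw [div_le_iff₀ (by positivity)] at this
      rw [hD]
      linarith) (by omega)
  refine ⟨closings 𝒞 W, ?_, ?_, ?_, ?_⟩
  · intro q hq
    have hq' := mem_filter.1 hq
    have hc := h𝒞 q.1 (mem_product.1 hq'.1).1
    exact ⟨hc, hq'.2.1, hq'.2.2.1, closing_subset_vertexPairs hq, hq'.2.2.2, card_closing hc.1⟩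
  · have h1 : (#𝒞 : ℝ) * n ≤ 2 * #(closings 𝒞 W) := by
      rw [hndef]
      exact_mod_cast le_card_closings 𝒞 hW.degree_le hn
    have h2 : m ^ 2 / (64 * n) ≤ #𝒞 := by rw [hcard]; exact Nat.le_ceil _
    rw [div_le_iff₀ (by positivity)] at h2
    nlinarith
  · have h1 : (#(closings 𝒞 W) : ℝ) ≤ #𝒞 * n := by
      rw [hndef]
      exact_mod_cast card_closings_le 𝒞 W
    have h2 : (#𝒞 : ℝ) ≤ m ^ 2 / (64 * n) + 1 := by
      rw [hcard]
      exact (Nat.ceil_lt_add_one (by positivity)).le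
    have h3 : (#𝒞 : ℝ) * n ≤ (m ^ 2 / (64 * n) + 1) * n := by gcongr
    have h4 : (m ^ 2 / (64 * n) + 1) * n = m ^ 2 / 64 + n := by field_simp
    nlinarith
  · intro i hi
    refine (sum_closings_le hp0.le hp1 h𝒞 h𝒞D hP.codegree_le hi).trans ?_
    have h1 : (D : ℝ) ≤ m * d / (8 * n) + 1 := (Nat.ceil_lt_add_one (by positivity)).le
    have h2 : 4 * (D : ℝ) * p ≤ 4 * (m * d / (8 * n) + 1) * p := by gcongr
    have h3 : 4 * (m * d / (8 * n) + 1) * p = 3 * (p * m * √(p * m)) / n + 4 * p := by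
      rw [hd]; field_simp; ring
    linarith

end Closings

/-! ### Typical graphs -/

section Typical

variable {V : Type*} [Fintype V] [LinearOrder V]

lemma subsetPr_degree_le {p : ℝ} (hp0 : 0 ≤ p) (hp1 : p ≤ 1 / 32) (x : V) :
    subsetPr (vertexPairs V) p (fun N => ¬ 8 * #(edgeNbrs N x) ≤ Fintype.card V)
      ≤ Real.exp (-(Fintype.card V : ℝ) / 20) := by
  classical
  set n : ℝ := (Fintype.card V : ℝ) with hn
  set F : Finset (Sym2 V) := (univ.erase x).image fun y => s(y, x) with hF
  have hFU : F ⊆ vertexPairs V := by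
    intro e he
    obtain ⟨y, hy, rfl⟩ := mem_image.1 he
    simpa [vertexPairs] using (mem_erase.1 hy).1
  have hFn : (#F : ℝ) ≤ n := by
    rw [hn]
    exact_mod_cast card_image_le.trans ((card_le_card (erase_subset _ _)).trans card_univ.le)
  have h1 : ∀ N ⊆ vertexPairs V, ¬ 8 * #(edgeNbrs N x) ≤ Fintype.card V → n / 8 ≤ #(F ∩ N) := by
    intro N hN h
    have h2 : #(edgeNbrs N x) ≤ #(F ∩ N) := by
      refine card_le_card_of_injOn (fun y => s(y, x)) ?_ ?_
      · intro y hy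
        have hy' := mem_edgeNbrs.1 hy
        have hyx : y ≠ x := by simpa [vertexPairs] using hN hy'
        exact mem_inter.2 ⟨mem_image.2 ⟨y, by simpa using hyx, rfl⟩, hy'⟩
      · intro y _ y' _ h
        exact Sym2.congr_left.1 h
    have h3 : Fintype.card V ≤ 8 * #(F ∩ N) := by omega
    have h4 : n ≤ 8 * #(F ∩ N) := by rw [hn]; exact_mod_cast h3
    linarith
  refine (subsetPr_mono hp0 (by linarith) h1).trans
    ((subsetPr_card_inter_ge_le hFU hp0 (by linarith) (n / 8)).trans ?_)
  rw [Real.rpow_def_of_pos (by norm_num), ← Real.exp_add]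
  refine Real.exp_le_exp.2 ?_
  have h2 := Real.log_two_gt_d9
  have hn0 : 0 ≤ n := by positivity
  have h3 : p * #F ≤ 1 / 32 * n := mul_le_mul hp1 hFn (by positivity) (by norm_num)
  nlinarith

lemma subsetPr_card_sym2_inter_le {p : ℝ} (hp0 : 0 ≤ p) (hp1 : p ≤ 1) (X : Finset V) :
    subsetPr (vertexPairs V) p (fun N => ¬ (#(X.sym2 ∩ N) : ℝ) ≤
      2 * p * (#X : ℝ) ^ 2 + 2 * Fintype.card V) ≤ (1 / 4) ^ (Fintype.card V) := by
  set n : ℝ := (Fintype.card V : ℝ) with hn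
  set F : Finset (Sym2 V) := X.sym2 ∩ vertexPairs V with hF
  have hFX : (#F : ℝ) ≤ (#X : ℝ) ^ 2 := by
    have h1 : #F ≤ (#X + 1).choose 2 := (card_le_card inter_subset_left).trans (card_sym2 X).le
    have h2 : (#X + 1).choose 2 ≤ #X ^ 2 := by
      rw [Nat.choose_two_right, Nat.add_sub_cancel]
      rcases Nat.eq_zero_or_pos #X with h | h
      · simp [h]
      · refine Nat.div_le_of_le_mul ?_
        nlinarith
    exact_mod_cast h1.trans h2
  refine (subsetPr_mono hp0 hp1 (B := fun N => 2 * p * (#X : ℝ) ^ 2 + 2 * n ≤ #(F ∩ N))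
    fun N hN h => ?_).trans
    ((subsetPr_card_inter_ge_le inter_subset_right hp0 hp1 _).trans ?_)
  · rw [hF, inter_assoc, inter_eq_right.2 hN]
    exact (not_le.1 h).le
  · rw [Real.rpow_def_of_pos (by norm_num), ← Real.exp_add]
    have h3 : ((1 : ℝ) / 4) ^ (Fintype.card V) = Real.exp (Real.log 2 * (-(2 * n))) := by
      have h4 : Real.log 2 * (-(2 * n)) = (Fintype.card V : ℝ) * (-(Real.log 2 + Real.log 2)) := by
        rw [hn]; ring
      rw [h4, Real.exp_nat_mul, Real.exp_neg, Real.exp_add, Real.exp_log (by norm_num)]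
      norm_num
    rw [h3]
    refine Real.exp_le_exp.2 ?_
    have h4 := Real.log_two_gt_d9
    have h5 : p * #F ≤ p * (#X : ℝ) ^ 2 := by gcongr
    have h6 : 0 ≤ p * (#X : ℝ) ^ 2 := by positivity
    nlinarith

lemma subsetPr_codegree_le {p : ℝ} (hp0 : 0 ≤ p) (hp1 : p ≤ 1) (κ : ℕ) {x y : V} (hxy : x < y) :
    subsetPr (vertexPairs V) p (fun N => ¬ #{u | s(x, u) ∈ N ∧ s(y, u) ∈ N} ≤ κ)
      ≤ (Fintype.card V * p ^ 2) ^ κ := by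
  classical
  set F : Finset V → Finset (Sym2 V) := fun K => K.biUnion fun u => {s(x, u), s(y, u)} with hF
  set 𝓚 : Finset (Finset V) := (univ \ {x, y}).powersetCard κ with h𝓚
  refine (subsetPr_mono hp0 hp1 (B := fun N => ∃ K ∈ 𝓚, F K ⊆ N) fun N hN h => ?_).trans
    ((subsetPr_exists_le hp0 hp1 𝓚 fun K N => F K ⊆ N).trans ?_)
  · obtain ⟨K, hK, hKκ⟩ := exists_subset_card_eq (not_le.1 h).le
    refine ⟨K, mem_powersetCard.2 ⟨fun u hu => ?_, hKκ⟩, biUnion_subset.2 fun u hu => ?_⟩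
    · have hu' := (mem_filter.1 (hK hu)).2
      have h1 : x ≠ u := by simpa [vertexPairs] using hN hu'.1
      have h2 : y ≠ u := by simpa [vertexPairs] using hN hu'.2
      simp [h1.symm, h2.symm]
    · have hu' := (mem_filter.1 (hK hu)).2
      simp [insert_subset_iff, hu']
  · have h1 : ∀ K ∈ 𝓚, subsetPr (vertexPairs V) p (fun N => F K ⊆ N) = (p ^ 2) ^ κ := by
      intro K hK
      obtain ⟨hKxy, hKκ⟩ := mem_powersetCard.1 hK
      have hne : ∀ u ∈ K, u ≠ x ∧ u ≠ y := fun u hu => by simpa using hKxy hu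
      rw [subsetPr_superset]
      · have hcard : #(F K) = 2 * κ := by
          rw [hF, card_biUnion]
          · rw [sum_congr rfl (g := fun _ => 2), sum_const, hKκ, smul_eq_mul, mul_comm]
            intro u hu
            refine card_pair fun h => hxy.ne ?_
            exact Sym2.congr_left.1 h
          · intro u hu u' hu' huu'
            refine Finset.disjoint_left.2 fun e he he' => ?_
            simp only [mem_insert, mem_singleton] at he he'
            have h2 := hne u hu
            have h3 := hne u' hu'
            have h4 := hxy.ne
            rcases he with rfl | rfl <;> simp only [Sym2.eq_iff] at he' <;> grind
        rw [hcard, pow_mul]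
      · refine biUnion_subset.2 fun u hu => ?_
        have h2 := hne u hu
        simp [insert_subset_iff, vertexPairs, h2.1.symm, h2.2.symm]
    rw [sum_congr rfl h1, sum_const, nsmul_eq_mul, mul_pow]
    refine mul_le_mul_of_nonneg_right ?_ (by positivity)
    have h2 : #𝓚 ≤ Fintype.card V ^ κ := by
      rw [h𝓚, card_powersetCard]
      refine (Nat.choose_le_pow _ _).trans (Nat.pow_le_pow_left ?_ _)
      exact (card_le_card (subset_univ _)).trans card_univ.le
    exact_mod_cast h2

lemma subsetPr_not_isTypical_le {p : ℝ} (hp0 : 0 ≤ p) (hp1 : p ≤ 1 / 32) (κ : ℕ) :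
    subsetPr (vertexPairs V) p (fun N => ¬ IsTypical p κ N)
      ≤ Fintype.card V * Real.exp (-(Fintype.card V : ℝ) / 20) + (1 / 2) ^ Fintype.card V
        + (Fintype.card V : ℝ) ^ 2 * (Fintype.card V * p ^ 2) ^ κ := by
  classical
  have hp1' : p ≤ 1 := by linarith
  have h1 : subsetPr (vertexPairs V) p (fun N => ∃ x ∈ (univ : Finset V),
      ¬ 8 * #(edgeNbrs N x) ≤ Fintype.card V)
      ≤ Fintype.card V * Real.exp (-(Fintype.card V : ℝ) / 20) := by
    refine (subsetPr_exists_le hp0 hp1' _ fun x N => ¬ 8 * #(edgeNbrs N x) ≤ Fintype.card V).trans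
      ((sum_le_sum fun x _ => subsetPr_degree_le hp0 hp1 x).trans ?_)
    rw [sum_const, card_univ, nsmul_eq_mul]
  have h2 : subsetPr (vertexPairs V) p (fun N => ∃ X ∈ (univ : Finset (Finset V)),
      ¬ (#(X.sym2 ∩ N) : ℝ) ≤ 2 * p * (#X : ℝ) ^ 2 + 2 * Fintype.card V)
      ≤ (1 / 2) ^ Fintype.card V := by
    refine (subsetPr_exists_le hp0 hp1' _ fun X N =>
      ¬ (#(X.sym2 ∩ N) : ℝ) ≤ 2 * p * (#X : ℝ) ^ 2 + 2 * Fintype.card V).trans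
      ((sum_le_sum fun X _ => subsetPr_card_sym2_inter_le hp0 hp1' X).trans ?_)
    rw [sum_const, card_univ, nsmul_eq_mul, Fintype.card_finset]
    push_cast
    rw [← mul_pow]
    norm_num
  have h3 : subsetPr (vertexPairs V) p (fun N => ∃ q ∈ ({q | q.1 < q.2} : Finset (V × V)),
      ¬ #{u | s(q.1, u) ∈ N ∧ s(q.2, u) ∈ N} ≤ κ)
      ≤ (Fintype.card V : ℝ) ^ 2 * (Fintype.card V * p ^ 2) ^ κ := by
    refine (subsetPr_exists_le hp0 hp1' ({q | q.1 < q.2} : Finset (V × V)) fun q N =>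
      ¬ #{u | s(q.1, u) ∈ N ∧ s(q.2, u) ∈ N} ≤ κ).trans ?_
    have h4 : ∀ q ∈ ({q | q.1 < q.2} : Finset (V × V)), subsetPr (vertexPairs V) p
        (fun N => ¬ #{u | s(q.1, u) ∈ N ∧ s(q.2, u) ∈ N} ≤ κ) ≤ (Fintype.card V * p ^ 2) ^ κ := by
      intro q hq
      rw [mem_filter] at hq
      exact subsetPr_codegree_le hp0 hp1' κ hq.2
    refine (sum_le_sum h4).trans ?_
    rw [sum_const, nsmul_eq_mul]
    refine mul_le_mul_of_nonneg_right ?_ (by positivity)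
    have : #({q | q.1 < q.2} : Finset (V × V)) ≤ Fintype.card V ^ 2 := by
      refine (card_le_card (subset_univ _)).trans ?_
      rw [card_univ, Fintype.card_prod, sq]
    exact_mod_cast this
  refine le_trans (subsetPr_mono hp0 hp1' fun N _ hN => ?_)
    ((subsetPr_or_le hp0 hp1').trans (add_le_add ((subsetPr_or_le hp0 hp1').trans
      (add_le_add h1 h2)) h3))
  by_contra hcon
  push Not at hcon
  refine hN ⟨fun x => hcon.1.1 x (mem_univ _), fun X => hcon.1.2 X (mem_univ _),
    fun x y hxy => hcon.2 (x, y) (mem_filter.2 ⟨mem_univ _, hxy⟩)⟩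

end Typical

/-! ### Triangles and mixed cycles -/

section Bad

variable {V : Type} [Fintype V] [LinearOrder V]

/-- The edges of the complete graph on the vertex set `S`. -/
def cliqueEdges (S : Finset V) : Finset (Sym2 V) := {e ∈ S.sym2 | ¬ e.IsDiag}

/-- Every triangle in the graph with edge set `N` has an edge in `R`. -/
def HitsTriangles (N R : Finset (Sym2 V)) : Prop :=
  ∀ S : Finset V, #S = 3 → cliqueEdges S ⊆ N → ¬ Disjoint (cliqueEdges S) R

/-- The `4`-cycles `x u y v` in `N` whose edges at `u` lie in `R` and whose edges at `v` do not. -/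
def mixedCycles (N R : Finset (Sym2 V)) : Finset ((V × V × V) × V) :=
  {q | (q.1.2.1 < q.1.2.2 ∧ s(q.1.2.1, q.1.1) ∈ R ∧ s(q.1.2.2, q.1.1) ∈ R) ∧
    q.2 ≠ q.1.2.1 ∧ q.2 ≠ q.1.2.2 ∧ closing q ⊆ N \ R}

omit [Fintype V] in
lemma card_cliqueEdges (S : Finset V) : #(cliqueEdges S) = (#S).choose 2 := by
  rw [← Sym2.card_image_offDiag]
  congr 1
  ext e
  induction e using Sym2.ind with
  | _ a b =>
    simp only [cliqueEdges, mem_filter, mk_mem_sym2_iff, Sym2.mk_isDiag_iff, mem_image,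
      mem_offDiag, Prod.exists, Function.uncurry_apply_pair, Sym2.eq_iff]
    constructor
    · rintro ⟨⟨ha, hb⟩, hab⟩
      exact ⟨a, b, ⟨ha, hb, hab⟩, Or.inl ⟨rfl, rfl⟩⟩
    · rintro ⟨x, y, ⟨hx, hy, hxy⟩, ⟨rfl, rfl⟩ | ⟨rfl, rfl⟩⟩
      · exact ⟨⟨hx, hy⟩, hxy⟩
      · exact ⟨⟨hy, hx⟩, fun h => hxy h.symm⟩

lemma cliqueEdges_subset (S : Finset V) : cliqueEdges S ⊆ vertexPairs V := fun e he => by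
  simpa [vertexPairs] using (mem_filter.1 he).2

omit [Fintype V] in
lemma card_cliqueEdges_inter_le {S T : Finset V} (hS : #S = 3) (hT : #T = 3) (h : S ≠ T) :
    #(cliqueEdges S ∩ cliqueEdges T) ≤ 1 := by
  have h1 : cliqueEdges S ∩ cliqueEdges T ⊆ cliqueEdges (S ∩ T) := by
    intro e he
    simp only [cliqueEdges, mem_inter, mem_filter, mem_sym2_iff] at he ⊢
    exact ⟨fun a ha => ⟨he.1.1 a ha, he.2.1 a ha⟩, he.1.2⟩
  refine (card_le_card h1).trans ?_
  rw [card_cliqueEdges]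
  have h2 : #(S ∩ T) ≤ 2 := by
    by_contra hcon
    have h3 : S ∩ T = S := eq_of_subset_of_card_le inter_subset_left (by omega)
    have h4 : S ∩ T = T := eq_of_subset_of_card_le inter_subset_right (by omega)
    exact h (h3.symm.trans h4)
  calc (#(S ∩ T)).choose 2 ≤ Nat.choose 2 2 := Nat.choose_le_choose 2 h2
    _ = 1 := rfl

lemma card_filter_mem_cliqueEdges_le (e : Sym2 V) :
    #{T ∈ powersetCard 3 (univ : Finset V) | e ∈ cliqueEdges T} ≤ Fintype.card V := by
  classical
  induction e using Sym2.ind with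
  | _ a b =>
    rw [← card_univ]
    refine le_trans (card_le_card (t := (univ : Finset V).image fun c => {a, b, c}) ?_)
      card_image_le
    intro T hT
    simp only [mem_filter, mem_powersetCard, cliqueEdges, mk_mem_sym2_iff,
      Sym2.mk_isDiag_iff] at hT
    obtain ⟨⟨-, hT3⟩, ⟨ha, hb⟩, hab⟩ := hT
    have hsub : ({a, b} : Finset V) ⊆ T := by simp [insert_subset_iff, ha, hb]
    have h1 : #(T \ {a, b}) = 1 := by
      rw [card_sdiff_of_subset hsub, hT3, card_pair hab]
    obtain ⟨c, hc⟩ := card_eq_one.1 h1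
    refine mem_image.2 ⟨c, mem_univ c, ?_⟩
    have h2 := sdiff_union_of_subset hsub
    rw [hc] at h2
    rw [← h2]
    ext z
    simp only [mem_insert, mem_singleton, mem_union]
    tauto

/-- A sparse random graph contains edge-disjoint triangles in number proportional to the expected
number of all triangles. -/
lemma subsetPr_not_hasPacking_triangles_le {p : ℝ} (hp0 : 0 < p) (hp1 : p ≤ 1)
    (hnp : 6 * Fintype.card V * p ^ 2 ≤ 1) (k : ℕ)
    (hk : 512 * k ≤ p ^ 3 * ((Fintype.card V).choose 3 : ℝ)) :
    subsetPr (vertexPairs V) p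
        (fun N => ¬ HasPacking (powersetCard 3 (univ : Finset V)) cliqueEdges k N)
      ≤ Real.exp (-(p ^ 3 * (Fintype.card V).choose 3) / 32) := by
  classical
  set I := powersetCard 3 (univ : Finset V) with hI
  have hcard : #I = (Fintype.card V).choose 3 := by rw [hI, card_powersetCard, card_univ]
  have h3 : ∀ T ∈ I, #T = 3 := fun T hT => (mem_powersetCard.1 hT).2
  have hr : ∀ T ∈ I, #(cliqueEdges T) = 3 := fun T hT => by
    rw [card_cliqueEdges, h3 T hT]; rfl
  have h := subsetPr_superset_and_not_hasPacking_le (empty_subset (vertexPairs V)) hp0 hp1 I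
    cliqueEdges (fun T _ => cliqueEdges_subset T) 3 (by norm_num) hr (s := 1) one_pos le_rfl ?_ k
    (by rw [hcard]; linarith)
  · simpa [hcard] using h
  · intro T hT
    set J := {T' ∈ I | T' ≠ T ∧ ¬ Disjoint (cliqueEdges T) (cliqueEdges T')} with hJ
    have h1 : #J ≤ 3 * Fintype.card V := by
      have h2 : J ⊆ (cliqueEdges T).biUnion fun e => {T' ∈ I | e ∈ cliqueEdges T'} := by
        intro T' hT'
        obtain ⟨hT', -, hd⟩ := mem_filter.1 hT'
        obtain ⟨e, he, he'⟩ := not_disjoint_iff.1 hd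
        exact mem_biUnion.2 ⟨e, he, mem_filter.2 ⟨hT', he'⟩⟩
      refine (card_le_card h2).trans (card_biUnion_le.trans ?_)
      refine (sum_le_sum fun e _ => card_filter_mem_cliqueEdges_le e).trans ?_
      rw [sum_const, hr T hT, smul_eq_mul]
    have h2 : ∑ T' ∈ J, p ^ #(cliqueEdges T' \ cliqueEdges T) ≤ #J * p ^ 2 := by
      rw [← nsmul_eq_mul, ← sum_const]
      refine sum_le_sum fun T' hT' => pow_le_pow_of_le_one hp0.le hp1 ?_
      obtain ⟨hT', hne, -⟩ := mem_filter.1 hT'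
      have h4 := card_sdiff_add_card_inter (cliqueEdges T') (cliqueEdges T)
      have h5 := card_cliqueEdges_inter_le (h3 T' hT') (h3 T hT) hne
      have h6 := hr T' hT'
      omega
    have h4 : (#J : ℝ) ≤ 3 * Fintype.card V := by exact_mod_cast h1
    have h5 : (#J : ℝ) * p ^ 2 ≤ 3 * Fintype.card V * p ^ 2 := by gcongr
    linarith

end Bad

section Witness

variable {α ι : Type*} [DecidableEq α]

/-- The weighted number of packings of size `k` together with a choice of `k` of their elements is
exponential in `k`. -/
lemma sum_packings_le (I : Finset ι) (A : ι → Finset α) (r : ℕ) (hr : ∀ i ∈ I, #(A i) = r) {p : ℝ}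
    (hp0 : 0 ≤ p) (k : ℕ) :
    ∑ M ∈ powersetCard k I, ∑ _P ∈ powersetCard k (M.biUnion A), p ^ (r * k)
      ≤ (2 ^ r) ^ k * Real.exp (p ^ r * #I) := by
  classical
  have h1 : ∀ M ∈ powersetCard k I,
      ∑ _P ∈ powersetCard k (M.biUnion A), p ^ (r * k) ≤ (2 ^ r) ^ k * (p ^ r) ^ k := by
    intro M hM
    obtain ⟨hMI, hMk⟩ := mem_powersetCard.1 hM
    rw [sum_const, nsmul_eq_mul, ← pow_mul p]
    refine mul_le_mul_of_nonneg_right ?_ (by positivity)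
    have h2 : #(powersetCard k (M.biUnion A)) ≤ 2 ^ (r * k) := by
      have h3 : #(M.biUnion A) ≤ r * k := by
        refine card_biUnion_le.trans ?_
        rw [sum_congr rfl fun i hi => hr i (hMI hi), sum_const, hMk, smul_eq_mul, mul_comm]
      calc #(powersetCard k (M.biUnion A)) ≤ #(M.biUnion A).powerset :=
            card_le_card fun P hP => mem_powerset.2 (mem_powersetCard.1 hP).1
        _ = 2 ^ #(M.biUnion A) := card_powerset _
        _ ≤ 2 ^ (r * k) := Nat.pow_le_pow_right (by norm_num) h3
    rw [← pow_mul]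
    exact_mod_cast h2
  refine (sum_le_sum h1).trans ?_
  rw [sum_const, card_powersetCard, nsmul_eq_mul, mul_left_comm]
  refine mul_le_mul_of_nonneg_left ?_ (by positivity)
  calc ((#I).choose k : ℝ) * (p ^ r) ^ k ≤ (p ^ r + 1) ^ #I := by
        rw [add_pow]
        by_cases hk : k ≤ #I
        · refine le_trans (le_of_eq ?_) (single_le_sum
            (f := fun j => (p ^ r) ^ j * 1 ^ (#I - j) * ((#I).choose j : ℝ))
            (fun j _ => by positivity) (mem_range.2 (Nat.lt_succ_of_le hk)))
          ring
        · rw [Nat.choose_eq_zero_of_lt (not_le.1 hk)]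
          simp only [Nat.cast_zero, zero_mul]
          exact sum_nonneg fun j _ => by positivity
    _ ≤ (Real.exp (p ^ r)) ^ #I := by
        gcongr
        exact Real.add_one_le_exp _
    _ = Real.exp (p ^ r * #I) := by rw [← Real.exp_nat_mul, mul_comm]

/-- A set which meets all members of a packing of size `k` contains `k` elements of its union. -/
lemma exists_subset_of_meets {M : Finset ι} {A : ι → Finset α}
    (hd : (M : Set ι).PairwiseDisjoint A) {R : Finset α} (h : ∀ i ∈ M, ¬ Disjoint (A i) R) :
    ∃ P ∈ powersetCard #M (M.biUnion A), P ⊆ R := by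
  classical
  have h' : ∀ i : M, ∃ a, a ∈ A i ∧ a ∈ R := fun i => not_disjoint_iff.1 (h i i.2)
  choose f hfA hfR using h'
  refine ⟨univ.image f, mem_powersetCard.2 ⟨?_, ?_⟩, ?_⟩
  · intro a ha
    obtain ⟨i, -, rfl⟩ := mem_image.1 ha
    exact mem_biUnion.2 ⟨i, i.2, hfA i⟩
  · rw [card_image_of_injective, card_univ, Fintype.card_coe]
    intro i j hij
    by_contra hne
    have hne' : (i : ι) ≠ j := fun h => hne (Subtype.ext h)
    exact Finset.disjoint_left.1 (hd i.2 j.2 hne') (hfA i) (hij ▸ hfA j)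
  · intro a ha
    obtain ⟨i, -, rfl⟩ := mem_image.1 ha
    exact hfR i

end Witness

/-! ### Growth of the forced red edges -/

section Growth

variable {V : Type} [Fintype V] [LinearOrder V]

/-- There is a family of pairs `(P, W)` with `|P| = m` and `P ⊆ W` such that the expected number of
members with `W ⊆ N` is at most `exp (C m)`, and such that the following holds except with
probability `δ`: if `N` is typical and `R ⊆ N` hits all triangles but creates fewer than `z` mixed
cycles, then some member satisfies `P ⊆ R` and `W ⊆ N`. Besides `P`, the set `W` contains the other edges of
the triangles or closings which force `P` into `R`. Their presence in `N` is what makes the weighted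
number of members exponential in `m`, without the factor `log (n ^ 2 p / m)` in the exponent which
counts all sets of `m` edges. -/
def HasWitnessFamily (V : Type) [Fintype V] [LinearOrder V] (p : ℝ) (κ : ℕ) (z C : ℝ) (m : ℕ)
    (δ : ℝ) : Prop :=
  ∃ (σ : Type) (S : Finset σ) (P W : σ → Finset (Sym2 V)),
    (∀ i ∈ S, #(P i) = m ∧ P i ⊆ W i ∧ W i ⊆ vertexPairs V) ∧
    ∑ i ∈ S, p ^ #(W i) ≤ Real.exp (C * m) ∧
    subsetPr (vertexPairs V) p (fun N => IsTypical p κ N ∧ ∃ R ⊆ N, HitsTriangles N R ∧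
      (#(mixedCycles N R) : ℝ) < z ∧ ∀ i ∈ S, ¬ (P i ⊆ R ∧ W i ⊆ N)) ≤ δ

lemma HasWitnessFamily.mono {p : ℝ} {κ : ℕ} {z C : ℝ} {m : ℕ} {δ δ' : ℝ}
    (h : HasWitnessFamily V p κ z C m δ) (hδ : δ ≤ δ') : HasWitnessFamily V p κ z C m δ' := by
  obtain ⟨σ, S, P, W, h1, h2, h3⟩ := h
  exact ⟨σ, S, P, W, h1, h2, h3.trans hδ⟩

/-- The first witness family consists of choices of one edge from each triangle of a packing. -/
lemma hasWitnessFamily_triangles {p : ℝ} (hp0 : 0 < p) (hp1 : p ≤ 1)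
    (hnp : 6 * Fintype.card V * p ^ 2 ≤ 1) (κ : ℕ) (z : ℝ) {C : ℝ} (k : ℕ)
    (hk : 512 * k ≤ p ^ 3 * ((Fintype.card V).choose 3 : ℝ))
    (hC : p ^ 3 * ((Fintype.card V).choose 3 : ℝ) + 3 * k ≤ C * k) :
    HasWitnessFamily V p κ z C k
      (Real.exp (-(p ^ 3 * (Fintype.card V).choose 3) / 32)) := by
  classical
  set I := powersetCard 3 (univ : Finset V) with hI
  have hcard : #I = (Fintype.card V).choose 3 := by rw [hI, card_powersetCard, card_univ]
  have hr : ∀ T ∈ I, #(cliqueEdges T) = 3 := fun T hT => by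
    rw [card_cliqueEdges, (mem_powersetCard.1 hT).2]; rfl
  set 𝓜 : Finset (Finset (Finset V)) :=
    {M ∈ powersetCard k I | (M : Set (Finset V)).PairwiseDisjoint cliqueEdges} with h𝓜
  refine ⟨(_ : Finset (Finset V)) × Finset (Sym2 V),
    𝓜.sigma fun M => powersetCard k (M.biUnion cliqueEdges), fun i => i.2,
    fun i => i.1.biUnion cliqueEdges, ?_, ?_, ?_⟩
  · rintro ⟨M, P⟩ h
    obtain ⟨-, hP⟩ := mem_sigma.1 h
    obtain ⟨hP, hPk⟩ := mem_powersetCard.1 hP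
    exact ⟨hPk, hP, biUnion_subset.2 fun T _ => cliqueEdges_subset T⟩
  · rw [sum_sigma]
    have h1 : ∀ M ∈ 𝓜, ∑ _P ∈ powersetCard k (M.biUnion cliqueEdges),
        p ^ #(M.biUnion cliqueEdges)
        = ∑ _P ∈ powersetCard k (M.biUnion cliqueEdges), p ^ (3 * k) := by
      intro M hM
      obtain ⟨hM, hd⟩ := mem_filter.1 hM
      obtain ⟨hMI, hMk⟩ := mem_powersetCard.1 hM
      have h2 : #(M.biUnion cliqueEdges) = 3 * k := by
        rw [card_biUnion hd, sum_congr rfl fun i hi => hr i (hMI hi), sum_const, hMk, smul_eq_mul,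
          mul_comm]
      rw [h2]
    rw [sum_congr rfl h1]
    refine (sum_le_sum_of_subset_of_nonneg (filter_subset _ _) fun _ _ _ =>
      sum_nonneg fun _ _ => by positivity).trans
      ((sum_packings_le I cliqueEdges 3 hr hp0.le k).trans ?_)
    have h2 : ((2 : ℝ) ^ 3) ^ k ≤ Real.exp (3 * k) := by
      rw [mul_comm, Real.exp_nat_mul]
      gcongr
      have h3 : (2 : ℝ) ≤ Real.exp 1 := by linarith [Real.add_one_le_exp (1 : ℝ)]
      calc (2 : ℝ) ^ 3 ≤ Real.exp 1 ^ 3 := by gcongr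
        _ = Real.exp 3 := by rw [← Real.exp_nat_mul]; norm_num
    calc ((2 : ℝ) ^ 3) ^ k * Real.exp (p ^ 3 * #I)
        ≤ Real.exp (3 * k) * Real.exp (p ^ 3 * #I) := by gcongr
      _ ≤ Real.exp (C * k) := by
          rw [← Real.exp_add, hcard]
          exact Real.exp_le_exp.2 (by linarith)
  · refine le_trans (subsetPr_mono hp0.le hp1 fun N _ h => ?_)
      (subsetPr_not_hasPacking_triangles_le hp0 hp1 hnp k hk)
    obtain ⟨-, R, -, hR, -, hno⟩ := h
    rintro ⟨M, hMI, hMk, hMd, hMN⟩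
    obtain ⟨P, hP, hPR⟩ := exists_subset_of_meets hMd
      fun T hT => hR T (mem_powersetCard.1 (hMI hT)).2 (hMN T hT)
    rw [hMk] at hP
    exact hno ⟨M, P⟩ (mem_sigma.2 ⟨mem_filter.2 ⟨mem_powersetCard.2 ⟨hMI, hMk⟩, hMd⟩, hP⟩)
      ⟨hPR, biUnion_subset.2 hMN⟩

/-- The disjoint closings of a part `P` of `R` are either mostly untouched by `R`, or they force
further elements of `R`. -/
lemma card_mixedCycles_ge_or {N R P W : Finset (Sym2 V)} (hPR : P ⊆ R) {k : ℕ}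
    {I : Finset ((V × V × V) × V)}
    (hI : ∀ q ∈ I, IsCherry P q.1 ∧ q.2 ≠ q.1.2.1 ∧ q.2 ≠ q.1.2.2 ∧
        closing q ⊆ vertexPairs V ∧ Disjoint (closing q) W ∧ #(closing q) = 2)
    (hpack : HasPacking I closing (2 * k) N) :
    k ≤ #(mixedCycles N R) ∨ ∃ M ∈ powersetCard k I,
      (M : Set ((V × V × V) × V)).PairwiseDisjoint closing ∧ (∀ q ∈ M, closing q ⊆ N) ∧
      ∃ P' ∈ powersetCard k (M.biUnion closing), P' ⊆ R := by
  classical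
  obtain ⟨M, hMI, hMk, hMd, hMN⟩ := hpack
  by_cases hk : k ≤ #{q ∈ M | Disjoint (closing q) R}
  · left
    refine hk.trans (card_le_card fun q hq => ?_)
    obtain ⟨hqM, hqR⟩ := mem_filter.1 hq
    obtain ⟨⟨h1, h2, h3⟩, h4, h5, -⟩ := hI q (hMI hqM)
    exact mem_filter.2 ⟨mem_univ _, ⟨h1, hPR h2, hPR h3⟩, h4, h5, fun e he =>
      mem_sdiff.2 ⟨hMN q hqM he, Finset.disjoint_left.1 hqR he⟩⟩
  · right
    have h1 := card_filter_add_card_filter_not (s := M) fun q => Disjoint (closing q) R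
    obtain ⟨M', hM', hM'k⟩ := exists_subset_card_eq
      (show k ≤ #{q ∈ M | ¬ Disjoint (closing q) R} by omega)
    have hM'M : M' ⊆ M := hM'.trans (filter_subset _ _)
    have hd : (M' : Set ((V × V × V) × V)).PairwiseDisjoint closing :=
      hMd.subset (by exact_mod_cast hM'M)
    obtain ⟨P', hP', hP'R⟩ := exists_subset_of_meets hd fun q hq => (mem_filter.1 (hM' hq)).2
    rw [hM'k] at hP'
    exact ⟨M', mem_powersetCard.2 ⟨hM'M.trans hMI, hM'k⟩, hd, fun q hq => hMN q (hM'M hq),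
      P', hP', hP'R⟩

/-- One step of the growth: if the elements of `P` are forced into `R`, then their paths of length
two have many disjoint closings. As few of the resulting `4`-cycles are mixed, at least
`k` further edges are forced into `R`, where `k` is of order `p ^ 2 m ^ 2`. The choice of these edges
among the closings costs only a factor exponential in `k`.

There are between `m ^ 2 / 128` and `m ^ 2 / 32` closings to choose from. With `s = 1 / 100` the packing
bound provides `2 k` disjoint ones if `2 * 10 ^ 9 * k ≤ p ^ 2 m ^ 2`. The rate `3 * 10 ^ 8` accounts for
the choice among the closings, at most `exp (2 k + p ^ 2 m ^ 2 / 32)`, and for the previous family. -/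
lemma HasWitnessFamily.step {p : ℝ} (hp0 : 0 < p) (hp1 : p ≤ 1) {κ : ℕ} (hκ : κ ≤ 21) {z : ℝ}
    {m k : ℕ} {δ : ℝ} (h : HasWitnessFamily V p κ z (3 * 10 ^ 8) m δ)
    (hn : 8 ≤ Fintype.card V) (hm : 16 * Fintype.card V ≤ m)
    (hpm : 2 * 10 ^ 14 ≤ p ^ 2 * m) (hpn : p * m * √(p * m) ≤ Fintype.card V)
    (hk1 : 2 * 10 ^ 9 * (k : ℝ) ≤ p ^ 2 * m ^ 2) (hk2 : p ^ 2 * m ^ 2 ≤ 4 * 10 ^ 9 * (k : ℝ))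
    (hzk : z ≤ k) :
    HasWitnessFamily V p κ z (3 * 10 ^ 8) k (δ + Real.exp (-(m : ℝ))) := by
  classical
  obtain ⟨σ, S, P, W, hPW, hsum, hpr⟩ := h
  have hm0 : (0 : ℝ) ≤ m := by positivity
  set T : Finset σ := {i ∈ S | IsTypical p κ (W i)} with hT
  have hclos : ∀ i : σ, ∃ I : Finset ((V × V × V) × V), i ∈ T →
      (∀ q ∈ I, IsCherry (P i) q.1 ∧ q.2 ≠ q.1.2.1 ∧ q.2 ≠ q.1.2.2 ∧
        closing q ⊆ vertexPairs V ∧ Disjoint (closing q) (W i) ∧ #(closing q) = 2) ∧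
      (m : ℝ) ^ 2 ≤ 128 * #I ∧ 32 * (#I : ℝ) ≤ (m : ℝ) ^ 2 ∧
      ∀ q ∈ I, (1 / 100 : ℝ) * ∑ j ∈ I with j ≠ q ∧ ¬ Disjoint (closing q) (closing j),
        p ^ #(closing j \ closing q) ≤ 1 / 2 := by
    intro i
    by_cases hi : i ∈ T
    · obtain ⟨hiS, hiW⟩ := mem_filter.1 hi
      obtain ⟨h1, h2, -⟩ := hPW i hiS
      obtain ⟨I, hI1, hI2, hI3, hI4⟩ := exists_closings hp0 hp1 h2 hiW hn (by rw [h1]; exact hm)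
      rw [h1] at hI2 hI3
      refine ⟨I, fun _ => ⟨hI1, hI2, hI3, fun q hq => ?_⟩⟩
      have h3 := hI4 q hq
      rw [h1] at h3
      have h4 : 3 * (p * m * √(p * m)) / (Fintype.card V : ℝ) ≤ 3 := by
        have : (8 : ℝ) ≤ Fintype.card V := by exact_mod_cast hn
        rw [div_le_iff₀ (by linarith)]
        linarith
      have h5 : (κ : ℝ) ≤ 21 := by exact_mod_cast hκ
      linarith
    · exact ⟨∅, fun h => absurd h hi⟩
  choose I hI using hclos
  set 𝓜 : σ → Finset (Finset ((V × V × V) × V)) := fun i =>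
    {M ∈ powersetCard k (I i) | (M : Set ((V × V × V) × V)).PairwiseDisjoint closing} with h𝓜
  have hW'card : ∀ i ∈ T, ∀ M ∈ 𝓜 i, #(W i ∪ M.biUnion closing) = #(W i) + 2 * k := by
    intro i hi M hM
    obtain ⟨hM, hd⟩ := mem_filter.1 hM
    obtain ⟨hMI, hMk⟩ := mem_powersetCard.1 hM
    rw [card_union_of_disjoint, card_biUnion hd,
      sum_congr rfl fun q hq => ((hI i hi).1 q (hMI hq)).2.2.2.2.2, sum_const, hMk, smul_eq_mul,
      mul_comm k]
    rw [disjoint_biUnion_right]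
    exact fun q hq => ((hI i hi).1 q (hMI hq)).2.2.2.2.1.symm
  refine ⟨(_ : (_ : σ) × Finset ((V × V × V) × V)) × Finset (Sym2 V),
    (T.sigma 𝓜).sigma fun j => powersetCard k (j.2.biUnion closing), fun j => j.2,
    fun j => W j.1.1 ∪ j.1.2.biUnion closing, ?_, ?_, ?_⟩
  · rintro ⟨⟨i, M⟩, P'⟩ h
    obtain ⟨h, hP'⟩ := mem_sigma.1 h
    obtain ⟨hi, hM⟩ := mem_sigma.1 h
    obtain ⟨hP', hP'k⟩ := mem_powersetCard.1 hP'
    have hMI := (mem_powersetCard.1 (mem_filter.1 hM).1).1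
    refine ⟨hP'k, hP'.trans subset_union_right, union_subset (hPW i (mem_filter.1 hi).1).2.2 ?_⟩
    exact biUnion_subset.2 fun q hq => ((hI i hi).1 q (hMI hq)).2.2.2.1
  · have h1 : ∀ i ∈ T, ∑ M ∈ 𝓜 i, ∑ _P' ∈ powersetCard k (M.biUnion closing),
        p ^ #(W i ∪ M.biUnion closing)
        ≤ p ^ #(W i) * Real.exp (2 * k + p ^ 2 * m ^ 2 / 32) := by
      intro i hi
      have h2 : ∀ M ∈ 𝓜 i, ∑ _P' ∈ powersetCard k (M.biUnion closing),
          p ^ #(W i ∪ M.biUnion closing)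
          = p ^ #(W i) * ∑ _P' ∈ powersetCard k (M.biUnion closing), p ^ (2 * k) := by
        intro M hM
        rw [hW'card i hi M hM, pow_add, mul_sum]
      rw [sum_congr rfl h2, ← mul_sum]
      refine mul_le_mul_of_nonneg_left ?_ (by positivity)
      refine (sum_le_sum_of_subset_of_nonneg (filter_subset _ _) fun _ _ _ =>
        sum_nonneg fun _ _ => by positivity).trans ((sum_packings_le (I i) closing 2
          (fun q hq => ((hI i hi).1 q hq).2.2.2.2.2) hp0.le k).trans ?_)
      have h3 : ((2 : ℝ) ^ 2) ^ k ≤ Real.exp (2 * k) := by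
        rw [mul_comm, Real.exp_nat_mul]
        gcongr
        have h3 : (2 : ℝ) ≤ Real.exp 1 := by linarith [Real.add_one_le_exp (1 : ℝ)]
        calc (2 : ℝ) ^ 2 ≤ Real.exp 1 ^ 2 := by gcongr
          _ = Real.exp 2 := by rw [← Real.exp_nat_mul]; norm_num
      rw [Real.exp_add]
      refine mul_le_mul h3 (Real.exp_le_exp.2 ?_) (Real.exp_pos _).le (Real.exp_pos _).le
      have h4 := (hI i hi).2.2.1
      have h5 : 0 ≤ p ^ 2 := by positivity
      nlinarith
    rw [sum_sigma, sum_sigma]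
    refine (sum_le_sum h1).trans ?_
    rw [← sum_mul]
    have h2 : ∑ i ∈ T, p ^ #(W i) ≤ Real.exp (3 * 10 ^ 8 * m) :=
      (sum_le_sum_of_subset_of_nonneg (filter_subset _ _) fun _ _ _ => by positivity).trans hsum
    refine (mul_le_mul_of_nonneg_right h2 (Real.exp_pos _).le).trans ?_
    rw [← Real.exp_add]
    refine Real.exp_le_exp.2 ?_
    have h3 : 2 * 10 ^ 14 * (m : ℝ) ≤ 4 * 10 ^ 9 * k := by
      refine le_trans ?_ hk2
      nlinarith
    linarith
  · -- either the previous family fails, or some `(P, W)` has no large packing of closings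
    have hbad : ∀ i ∈ T, subsetPr (vertexPairs V) p
        (fun N => W i ⊆ N ∧ ¬ HasPacking (I i) closing (2 * k) N)
        ≤ p ^ #(W i) * Real.exp (-(3 * 10 ^ 8 + 1) * m) := by
      intro i hi
      obtain ⟨hI1, hI2, -, hI4⟩ := hI i hi
      have hI2' : p ^ 2 * (m : ℝ) ^ 2 ≤ 128 * (p ^ 2 * #(I i)) := by
        have : 0 ≤ p ^ 2 := by positivity
        nlinarith
      refine (subsetPr_superset_and_not_hasPacking_le (hPW i (mem_filter.1 hi).1).2.2 hp0 hp1 (I i)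
        closing (fun q hq => (hI1 q hq).2.2.2.1) 2 (by norm_num)
        (fun q hq => (hI1 q hq).2.2.2.2.2) (s := 1 / 100) (by norm_num) (by norm_num) hI4 (2 * k)
        ?_).trans ?_
      · push_cast
        linarith
      · refine mul_le_mul_of_nonneg_left (Real.exp_le_exp.2 ?_) (by positivity)
        have : 2 * 10 ^ 14 * (m : ℝ) ≤ p ^ 2 * m ^ 2 := by nlinarith
        linarith
    have hsplit : subsetPr (vertexPairs V) p (fun N => IsTypical p κ N ∧ ∃ R ⊆ N,
        HitsTriangles N R ∧ (#(mixedCycles N R) : ℝ) < z ∧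
        ∀ j ∈ (T.sigma 𝓜).sigma fun j => powersetCard k (j.2.biUnion closing),
          ¬ (j.2 ⊆ R ∧ W j.1.1 ∪ j.1.2.biUnion closing ⊆ N))
        ≤ subsetPr (vertexPairs V) p (fun N => (IsTypical p κ N ∧ ∃ R ⊆ N, HitsTriangles N R ∧
          (#(mixedCycles N R) : ℝ) < z ∧ ∀ i ∈ S, ¬ (P i ⊆ R ∧ W i ⊆ N)) ∨
          ∃ i ∈ T, W i ⊆ N ∧ ¬ HasPacking (I i) closing (2 * k) N) := by
      refine subsetPr_mono hp0.le hp1 fun N _ hN => ?_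
      obtain ⟨htyp, R, hRN, hRT, hmix, hno⟩ := hN
      by_contra hcon
      push Not at hcon
      obtain ⟨hcon1, hcon2⟩ := hcon
      obtain ⟨i, hiS, hiR, hiN⟩ := hcon1 htyp R hRN hRT hmix
      have hiT : i ∈ T := mem_filter.2 ⟨hiS, htyp.anti hiN⟩
      rcases card_mixedCycles_ge_or hiR (hI i hiT).1 (hcon2 i hiT hiN) with h1 | h1
      · have : (k : ℝ) ≤ #(mixedCycles N R) := by exact_mod_cast h1
        linarith
      · obtain ⟨M, hM, hMd, hMN, P', hP', hP'R⟩ := h1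
        exact hno ⟨⟨i, M⟩, P'⟩
          (mem_sigma.2 ⟨mem_sigma.2 ⟨hiT, mem_filter.2 ⟨hM, hMd⟩⟩, hP'⟩)
          ⟨hP'R, union_subset hiN (biUnion_subset.2 hMN)⟩
    refine hsplit.trans ((subsetPr_or_le hp0.le hp1).trans (add_le_add hpr ?_))
    refine (subsetPr_exists_le hp0.le hp1 T fun i N =>
      W i ⊆ N ∧ ¬ HasPacking (I i) closing (2 * k) N).trans ((sum_le_sum hbad).trans ?_)
    rw [← sum_mul]
    have h2 : ∑ i ∈ T, p ^ #(W i) ≤ Real.exp (3 * 10 ^ 8 * m) :=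
      (sum_le_sum_of_subset_of_nonneg (filter_subset _ _) fun _ _ _ => by positivity).trans hsum
    refine (mul_le_mul_of_nonneg_right h2 (Real.exp_pos _).le).trans ?_
    rw [← Real.exp_add]
    refine Real.exp_le_exp.2 ?_
    linarith

/-- Iterating the growth step: the forced part of `R` reaches any size `t` for which
`(p t) ^ (3 / 2) ≤ n`. -/
lemma HasWitnessFamily.grow {p : ℝ} (hp0 : 0 < p) (hp1 : p ≤ 1) {κ : ℕ} (hκ : κ ≤ 21) {z : ℝ}
    {m₀ t : ℕ} (hn : 8 ≤ Fintype.card V) (hm₀ : 16 * Fintype.card V ≤ m₀)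
    (hpm : 2 * 10 ^ 14 ≤ p ^ 2 * m₀) (hpn : p * t * √(p * t) ≤ Fintype.card V)
    (hz : 4 * 10 ^ 9 * z ≤ p ^ 2 * m₀ ^ 2) {m : ℕ} {δ : ℝ} (hm : m₀ ≤ m)
    (h : HasWitnessFamily V p κ z (3 * 10 ^ 8) m δ) :
    ∃ m' ≥ max t m, HasWitnessFamily V p κ z (3 * 10 ^ 8) m'
      (δ + (t - m : ℕ) * Real.exp (-(m₀ : ℝ))) := by
  induction hd : t - m using Nat.strong_induction_on generalizing m δ with
  | _ d ih =>
    by_cases hmt : t ≤ m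
    · refine ⟨m, max_le hmt le_rfl, h.mono ?_⟩
      have : 0 ≤ (d : ℝ) * Real.exp (-(m₀ : ℝ)) := by positivity
      linarith
    · have hmm : (m₀ : ℝ) ≤ m := by exact_mod_cast hm
      have hm0 : (0 : ℝ) ≤ m := by positivity
      have hp2 : 0 ≤ p ^ 2 := by positivity
      have hpm' : 2 * 10 ^ 14 ≤ p ^ 2 * m := hpm.trans (by gcongr)
      have hm16 : (16 * Fintype.card V : ℝ) ≤ m := by exact_mod_cast hm₀.trans hm
      have hn8 : (8 : ℝ) ≤ Fintype.card V := by exact_mod_cast hn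
      have hsq : 2 * 10 ^ 14 * (m : ℝ) ≤ p ^ 2 * m ^ 2 := by nlinarith
      set k : ℕ := ⌊p ^ 2 * m ^ 2 / (2 * 10 ^ 9)⌋₊ with hk
      have hk1 : (k : ℝ) ≤ p ^ 2 * m ^ 2 / (2 * 10 ^ 9) := Nat.floor_le (by positivity)
      have hk2 : p ^ 2 * m ^ 2 / (2 * 10 ^ 9) < k + 1 := Nat.lt_floor_add_one _
      rw [le_div_iff₀ (by norm_num)] at hk1
      rw [div_lt_iff₀ (by norm_num)] at hk2
      have hkm : (m : ℝ) + 1 ≤ k := by linarith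
      have hkm' : m + 1 ≤ k := by exact_mod_cast hkm
      have hzk : z ≤ k := by
        have : p ^ 2 * (m₀ : ℝ) ^ 2 ≤ p ^ 2 * m ^ 2 := by gcongr
        linarith
      have hmt' : (m : ℝ) ≤ t := by exact_mod_cast (not_le.1 hmt).le
      have hstep := h.step hp0 hp1 hκ hn (hm₀.trans hm) hpm'
        (le_trans (by gcongr) hpn) (k := k) (by linarith) (by linarith) hzk
      obtain ⟨m', hm't, hm'⟩ := ih (t - k) (by omega) (hm.trans (by omega)) hstep rfl
      refine ⟨m', (max_le_max le_rfl (by omega)).trans hm't, hm'.mono ?_⟩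
      have h1 : ((t - k : ℕ) : ℝ) + 1 ≤ d := by
        have : t - k + 1 ≤ d := by omega
        exact_mod_cast this
      have h2 : Real.exp (-(m : ℝ)) ≤ Real.exp (-(m₀ : ℝ)) := Real.exp_le_exp.2 (by linarith)
      have h3 := mul_le_mul_of_nonneg_right h1 (Real.exp_pos (-(m₀ : ℝ))).le
      linarith

end Growth

/-! ### Large sets of red edges -/

section Large

variable {V : Type} [Fintype V] [LinearOrder V]

lemma log_add_three_le_sqrt {y : ℝ} (hy : 10 ^ 20 ≤ y) : 12288 * (Real.log y + 3) ≤ √y := by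
  have hy0 : 0 < y := lt_of_lt_of_le (by norm_num) hy
  set w : ℝ := √(√y) with hw
  have hw2 : w ^ 2 = √y := Real.sq_sqrt (Real.sqrt_nonneg y)
  have hw4 : w ^ 4 = y := by
    rw [show w ^ 4 = (w ^ 2) ^ 2 by ring, hw2, Real.sq_sqrt hy0.le]
  have hw5 : 10 ^ 5 ≤ w := by
    refine Real.le_sqrt_of_sq_le (Real.le_sqrt_of_sq_le ?_)
    norm_num at hy ⊢
    exact hy
  have hlog : Real.log y = 4 * Real.log w := by
    rw [← hw4, Real.log_pow]; norm_num
  have h1 : Real.log w ≤ w - 1 := Real.log_le_sub_one_of_pos (by linarith)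
  rw [hlog, ← hw2]
  nlinarith

/-- A fixed typical graph `R` which is not too small and has few edges compared to `n ^ 2 p` creates
about `p ^ 2 m ^ 2` mixed cycles, except with a probability smaller than one over the number of
graphs with `m` edges. -/
lemma subsetPr_card_mixedCycles_lt_le {p : ℝ} (hp0 : 0 < p) (hp1 : p ≤ 1 / 32) {κ : ℕ}
    (hκ : 1 ≤ κ) (hn : 8 ≤ Fintype.card V) {R : Finset (Sym2 V)} (hRU : R ⊆ vertexPairs V)
    (hR : IsTypical p κ R) (hm : 16 * Fintype.card V ≤ #R)
    (hlow : 6144 * κ * (2 * Real.log (Fintype.card V) + 3) ≤ p ^ 2 * #R)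
    (hup : 10 ^ 20 * (#R : ℝ) ≤ (Fintype.card V : ℝ) ^ 2 * p) :
    subsetPr (vertexPairs V) p
        (fun N => R ⊆ N ∧ (#(mixedCycles N R) : ℝ) < p ^ 2 * (#R : ℝ) ^ 2 / 1024)
      ≤ (#R / (Fintype.card V : ℝ) ^ 2) ^ #R * Real.exp (-3 * #R) := by
  classical
  have hp1' : p ≤ 1 := by linarith
  obtain ⟨I, hI1, hI2, -, hI4⟩ := exists_closings hp0 hp1' subset_rfl hR hn hm
  set n : ℝ := (Fintype.card V : ℝ) with hndef
  set m : ℝ := (#R : ℝ) with hmdef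
  have hn8 : 8 ≤ n := by rw [hndef]; exact_mod_cast hn
  have hn0 : 0 < n := by linarith
  have hm16 : 16 * n ≤ m := by rw [hndef, hmdef]; exact_mod_cast hm
  have hm0 : 0 < m := by linarith
  have hκ' : (1 : ℝ) ≤ κ := by exact_mod_cast hκ
  set Q : ℝ := p * m * √(p * m) / n with hQ
  have hQ0 : 0 ≤ Q := by positivity
  set s : ℝ := (2 * κ + 6 * Q + 1)⁻¹ with hs
  have hden : 0 < 2 * κ + 6 * Q + 1 := by positivity
  have hs0 : 0 < s := inv_pos.2 hden
  have hs1 : s ≤ 1 := inv_le_one_of_one_le₀ (by linarith)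
  have hsI : ∀ i ∈ I, s * ∑ j ∈ I with j ≠ i ∧ ¬ Disjoint (closing i) (closing j),
      p ^ #(closing j \ closing i) ≤ 1 / 2 := by
    intro i hi
    have h1 := hI4 i hi
    have h2 : 3 * (p * m * √(p * m)) / n = 3 * Q := by rw [hQ, mul_div_assoc]
    rw [h2] at h1
    rw [hs, inv_mul_le_iff₀ hden]
    linarith
  set μ : ℝ := p ^ 2 * #I with hμ
  have hμm : p ^ 2 * m ^ 2 / 1024 ≤ μ / 8 := by
    have : 0 ≤ p ^ 2 := by positivity
    rw [hμ]
    nlinarith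
  -- the lower tail for the number of closings
  have htail : subsetPr (vertexPairs V) p
      (fun N => R ⊆ N ∧ (#(mixedCycles N R) : ℝ) < p ^ 2 * m ^ 2 / 1024)
      ≤ p ^ #R * Real.exp (-(s * μ / 8)) := by
    refine (subsetPr_mono hp0.le hp1' (B := fun N => R ⊆ N ∧
      (#{q ∈ I | closing q ⊆ N} : ℝ) ≤ μ / 8) fun N _ h => ⟨h.1, ?_⟩).trans ?_
    · have h1 : #{q ∈ I | closing q ⊆ N} ≤ #(mixedCycles N R) := by
        refine card_le_card fun q hq => ?_
        obtain ⟨hqI, hqN⟩ := mem_filter.1 hq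
        obtain ⟨h1, h2, h3, -, h5, -⟩ := hI1 q hqI
        exact mem_filter.2 ⟨mem_univ _, h1, h2, h3, subset_sdiff.2 ⟨hqN, h5⟩⟩
      have h2 : (#{q ∈ I | closing q ⊆ N} : ℝ) ≤ #(mixedCycles N R) := by exact_mod_cast h1
      linarith [h.2]
    · refine (subsetPr_superset_and_le hRU hp0.le hp1' fun N N' hNN' h => ?_).trans ?_
      · refine le_trans ?_ h
        have : #{q ∈ I | closing q ⊆ N} ≤ #{q ∈ I | closing q ⊆ N'} :=
          card_le_card fun q hq => by
            rw [mem_filter] at hq ⊢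
            exact ⟨hq.1, hq.2.trans hNN'⟩
        exact_mod_cast this
      · refine mul_le_mul_of_nonneg_left ?_ (by positivity)
        have h1 : subsetPr (vertexPairs V) p (fun N => (#{q ∈ I | closing q ⊆ N} : ℝ) ≤ μ / 8)
            ≤ subsetEx (vertexPairs V) p (fun N => Real.exp (s * (μ / 8)) *
              Real.exp (-s * #{q ∈ I | closing q ⊆ N})) := by
          refine subsetPr_le_subsetEx hp0.le hp1' (fun N _ => by positivity) fun N _ h => ?_
          rw [← Real.exp_add]
          exact Real.one_le_exp (by nlinarith)
        rw [subsetEx_const_mul] at h1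
        have h2 := subsetEx_exp_neg_le hp0.le hp1' I closing (fun q hq => (hI1 q hq).2.2.2.1) 2
          (fun q hq => (hI1 q hq).2.2.2.2.2) hs0.le hs1 hsI
        refine h1.trans ((mul_le_mul_of_nonneg_left h2 (Real.exp_pos _).le).trans ?_)
        rw [← Real.exp_add]
        refine Real.exp_le_exp.2 (le_of_eq ?_)
        rw [hμ]
        ring
  refine htail.trans ?_
  -- the exponent beats the entropy of the choice of `R`
  set y : ℝ := n ^ 2 * p / m with hy
  have hy20 : 10 ^ 20 ≤ y := by rw [hy, le_div_iff₀ hm0]; exact hup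
  have hy0 : 0 < y := lt_of_lt_of_le (by norm_num) hy20
  have hlogy : Real.log y ≤ 2 * Real.log n := by
    have h1 : y ≤ n ^ 2 := by
      rw [hy, div_le_iff₀ hm0]
      have : n ^ 2 * p ≤ n ^ 2 * 1 := by gcongr
      nlinarith [sq_nonneg n]
    calc Real.log y ≤ Real.log (n ^ 2) := Real.log_le_log hy0 h1
      _ = 2 * Real.log n := by rw [Real.log_pow]; norm_num
  have hlogy0 : 0 ≤ Real.log y := Real.log_nonneg (by linarith)
  have hexp : m * (Real.log y + 3) ≤ s * μ / 8 := by
    have h1 : 6144 * κ * (Real.log y + 3) ≤ p ^ 2 * m := by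
      refine le_trans ?_ hlow
      gcongr
    have h2 : 12288 * Q * (Real.log y + 3) ≤ p ^ 2 * m := by
      have h3 := log_add_three_le_sqrt hy20
      have h4 : Q * √y = p ^ 2 * m := by
        have h5 : √(p * m) * √y = n * p := by
          rw [← Real.sqrt_mul (by positivity), hy, show p * m * (n ^ 2 * p / m) = (n * p) ^ 2 by
            field_simp, Real.sqrt_sq (by positivity)]
        rw [hQ, div_mul_eq_mul_div, mul_assoc, h5]
        field_simp
      rw [← h4]
      nlinarith
    have h3 : 1024 * (2 * κ + 6 * Q + 1) * (Real.log y + 3) ≤ p ^ 2 * m := by nlinarith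
    have h4 : m * (Real.log y + 3) * (2 * κ + 6 * Q + 1) ≤ μ / 8 := by
      refine le_trans ?_ hμm
      nlinarith
    rw [hs, mul_div_assoc, inv_mul_eq_div, le_div_iff₀ hden]
    exact h4
  calc p ^ #R * Real.exp (-(s * μ / 8))
      ≤ p ^ #R * Real.exp (-(m * (Real.log y + 3))) := by gcongr
    _ = (m / n ^ 2) ^ #R * Real.exp (-3 * m) := by
        have h1 : Real.exp (-(m * (Real.log y + 3)))
            = (y⁻¹) ^ #R * Real.exp (-3 * m) := by
          rw [← Real.exp_log (inv_pos.2 hy0), ← Real.exp_nat_mul, ← Real.exp_add, Real.log_inv,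
            ← hmdef]
          ring_nf
        rw [h1, ← mul_assoc, ← mul_pow, hy]
        congr 2
        field_simp

/-- Union bound over all sets `R` with at least `t` edges. -/
lemma subsetPr_exists_large_le {p : ℝ} (hp0 : 0 < p) (hp1 : p ≤ 1 / 32) {κ : ℕ}
    (hκ : 1 ≤ κ) (hn : 8 ≤ Fintype.card V) {t : ℕ} (ht : 16 * Fintype.card V ≤ t)
    (hlow : 6144 * κ * (2 * Real.log (Fintype.card V) + 3) ≤ p ^ 2 * t) :
    subsetPr (vertexPairs V) p (fun N => IsTypical p κ N ∧ ∃ R ⊆ N, t ≤ #R ∧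
        10 ^ 20 * (#R : ℝ) ≤ (Fintype.card V : ℝ) ^ 2 * p ∧
        (#(mixedCycles N R) : ℝ) < p ^ 2 * (t : ℝ) ^ 2 / 1024)
      ≤ ((Fintype.card V : ℝ) ^ 2 + 1) * Real.exp (-2 * t) := by
  classical
  have hp1' : p ≤ 1 := by linarith
  set n : ℕ := Fintype.card V with hndef
  set U := vertexPairs V with hU
  have hUn : #U ≤ n ^ 2 := by
    have h1 : U = cliqueEdges univ := by ext e; simp [hU, vertexPairs, cliqueEdges]
    rw [h1, card_cliqueEdges, card_univ]
    exact Nat.choose_le_pow _ _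
  set 𝓡 : Finset (Finset (Sym2 V)) := {R ∈ U.powerset | IsTypical p κ R ∧ t ≤ #R ∧
    10 ^ 20 * (#R : ℝ) ≤ (n : ℝ) ^ 2 * p} with h𝓡
  set g : ℕ → ℝ := fun m => (m / (n : ℝ) ^ 2) ^ m * Real.exp (-3 * m) with hg
  have h1 : ∀ R ∈ 𝓡, subsetPr U p
      (fun N => R ⊆ N ∧ (#(mixedCycles N R) : ℝ) < p ^ 2 * (t : ℝ) ^ 2 / 1024) ≤ g #R := by
    intro R hR
    obtain ⟨hRU, hRtyp, hRt, hRup⟩ := mem_filter.1 hR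
    have hRt' : (t : ℝ) ≤ #R := by exact_mod_cast hRt
    refine (subsetPr_mono hp0.le hp1' fun N _ h => ⟨h.1, h.2.trans_le ?_⟩).trans
      (subsetPr_card_mixedCycles_lt_le hp0 hp1 hκ hn (mem_powerset.1 hRU) hRtyp (ht.trans hRt)
        (hlow.trans (by gcongr)) hRup)
    gcongr
  have h2 : ∑ R ∈ 𝓡, g #R ≤ ∑ m ∈ Icc t (n ^ 2), Real.exp (-2 * t) := by
    have h3 : 𝓡 ⊆ (Icc t (n ^ 2)).biUnion fun m => powersetCard m U := by
      intro R hR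
      obtain ⟨hRU, -, hRt, -⟩ := mem_filter.1 hR
      rw [mem_powerset] at hRU
      exact mem_biUnion.2 ⟨#R, mem_Icc.2 ⟨hRt, (card_le_card hRU).trans hUn⟩,
        mem_powersetCard.2 ⟨hRU, rfl⟩⟩
    have hg0 : ∀ m, 0 ≤ g m := fun m => by rw [hg]; positivity
    refine (sum_le_sum_of_subset_of_nonneg h3 fun _ _ _ => hg0 _).trans ?_
    rw [sum_biUnion fun i _ j _ hij => pairwise_disjoint_powersetCard U hij]
    refine sum_le_sum fun m hm => ?_
    have hmt : (t : ℝ) ≤ m := by exact_mod_cast (mem_Icc.1 hm).1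
    rw [sum_congr rfl (g := fun _ => g m) fun R hR => by rw [(mem_powersetCard.1 hR).2],
      sum_const, card_powersetCard, nsmul_eq_mul]
    have hn0 : (0 : ℝ) < (n : ℝ) ^ 2 := by
      have : 0 < n := by omega
      positivity
    have h4 : ((#U).choose m : ℝ) ≤ ((n : ℝ) ^ 2) ^ m / m.factorial := by
      refine (Nat.choose_le_pow_div m #U).trans ?_
      gcongr
      exact_mod_cast hUn
    have h5 : (m : ℝ) ^ m / m.factorial ≤ Real.exp m :=
      Real.pow_div_factorial_le_exp _ (by positivity) m
    calc ((#U).choose m : ℝ) * g m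
        ≤ ((n : ℝ) ^ 2) ^ m / m.factorial * g m := mul_le_mul_of_nonneg_right h4 (hg0 m)
      _ = (m : ℝ) ^ m / m.factorial * Real.exp (-3 * m) := by
          simp only [hg]
          rw [div_pow]
          field_simp
      _ ≤ Real.exp m * Real.exp (-3 * m) := by gcongr
      _ ≤ Real.exp (-2 * t) := by
          rw [← Real.exp_add]
          exact Real.exp_le_exp.2 (by linarith)
  refine (subsetPr_mono hp0.le hp1' (B := fun N => ∃ R ∈ 𝓡, R ⊆ N ∧
    (#(mixedCycles N R) : ℝ) < p ^ 2 * (t : ℝ) ^ 2 / 1024) fun N hN h => ?_).trans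
    ((subsetPr_exists_le hp0.le hp1' 𝓡 fun R N => R ⊆ N ∧
      (#(mixedCycles N R) : ℝ) < p ^ 2 * (t : ℝ) ^ 2 / 1024).trans
      ((sum_le_sum h1).trans (h2.trans ?_)))
  · obtain ⟨htyp, R, hRN, hRt, hRup, hmix⟩ := h
    exact ⟨R, mem_filter.2 ⟨mem_powerset.2 (hRN.trans hN), htyp.anti hRN, hRt, hRup⟩, hRN, hmix⟩
  · rw [sum_const, nsmul_eq_mul]
    refine mul_le_mul_of_nonneg_right ?_ (Real.exp_pos _).le
    have : #(Icc t (n ^ 2)) ≤ n ^ 2 + 1 := by rw [Nat.card_Icc]; omega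
    exact_mod_cast this

end Large

/-! ### The failure probability -/

section Quantitative

variable {V : Type} [Fintype V] [LinearOrder V]

/-- Some set `R` of at most `10 ^ (-20) n ^ 2 p` edges of `N` meets all triangles in `N`, but creates
fewer than `z` mixed cycles. -/
def IsBad (p z : ℝ) (N : Finset (Sym2 V)) : Prop :=
  ∃ R ⊆ N, HitsTriangles N R ∧ 10 ^ 20 * (#R : ℝ) ≤ (Fintype.card V : ℝ) ^ 2 * p ∧
    (#(mixedCycles N R) : ℝ) < z

lemma choose_three_bounds {n : ℕ} (hn : 6 ≤ n) :
    (n : ℝ) ^ 3 ≤ 12 * (n.choose 3 : ℝ) ∧ 6 * (n.choose 3 : ℝ) ≤ (n : ℝ) ^ 3 := by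
  have h1 : (6 : ℝ) * (n.choose 3 : ℝ) = n * (n - 1) * (n - 2) := by
    have h2 := Nat.descFactorial_eq_factorial_mul_choose n 3
    have h3 : n.descFactorial 3 = n * (n - 1) * (n - 2) := by
      simp [Nat.descFactorial]; ring
    rw [h3] at h2
    have h4 : ((n * (n - 1) * (n - 2) : ℕ) : ℝ) = ((Nat.factorial 3 * n.choose 3 : ℕ) : ℝ) := by
      rw [h2]
    push_cast [Nat.cast_sub (show 1 ≤ n by omega), Nat.cast_sub (show 2 ≤ n by omega),
      Nat.factorial] at h4
    linarith
  have hn' : (6 : ℝ) ≤ n := by exact_mod_cast hn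
  constructor
  · nlinarith [mul_nonneg (show (0 : ℝ) ≤ n by linarith) (show (0 : ℝ) ≤ n - 6 by linarith)]
  · nlinarith [mul_nonneg (show (0 : ℝ) ≤ n by linarith) (show (0 : ℝ) ≤ n - 6 by linarith)]

/-- The reduction of the bad event to the exceptional events: a witness family of size `m` forces
every bad set to have at least `m` edges, and then it is covered by the union bound. -/
lemma HasWitnessFamily.subsetPr_isBad_le {p : ℝ} (hp0 : 0 < p) (hp1 : p ≤ 1 / 32) {κ : ℕ}
    (hκ : 1 ≤ κ) (hn : 8 ≤ Fintype.card V) {z C δ : ℝ} {m : ℕ}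
    (h : HasWitnessFamily V p κ z C m δ) (hm : 16 * Fintype.card V ≤ m)
    (hlow : 6144 * κ * (2 * Real.log (Fintype.card V) + 3) ≤ p ^ 2 * m)
    (hz : 1024 * z ≤ p ^ 2 * m ^ 2) :
    subsetPr (vertexPairs V) p (IsBad p z)
      ≤ subsetPr (vertexPairs V) p (fun N => ¬ IsTypical p κ N) + δ
        + ((Fintype.card V : ℝ) ^ 2 + 1) * Real.exp (-2 * m) := by
  have hp1' : p ≤ 1 := by linarith
  obtain ⟨σ, S, P, W, h1, -, h3⟩ := h
  refine le_trans (subsetPr_mono hp0.le hp1' fun N _ hN => ?_)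
    ((subsetPr_or_le hp0.le hp1').trans (add_le_add ((subsetPr_or_le hp0.le hp1').trans
      (add_le_add le_rfl h3)) (subsetPr_exists_large_le hp0 hp1 hκ hn hm hlow)))
  obtain ⟨R, hRN, hRT, hRup, hmix⟩ := hN
  by_cases htyp : IsTypical p κ N
  · by_cases hex : ∀ i ∈ S, ¬ (P i ⊆ R ∧ W i ⊆ N)
    · exact Or.inl (Or.inr ⟨htyp, R, hRN, hRT, hmix, hex⟩)
    · push Not at hex
      obtain ⟨i, hi, hiR, -⟩ := hex
      refine Or.inr ⟨htyp, R, hRN, ?_, hRup, by linarith⟩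
      rw [← (h1 i hi).1]
      exact card_le_card hiR
  · exact Or.inl (Or.inl htyp)

/-- A bound on the probability that the random graph on `n` vertices is bad. The third summand bounds
the probability of a large codegree, in the sparse and in the dense case. -/
noncomputable def failureBound (n : ℕ) : ℝ :=
  n * Real.exp (-(n : ℝ) / 20) + (1 / 2) ^ n
    + ((n : ℝ) ^ (-(1 / 10) : ℝ) + (n : ℝ) ^ 2 * (1 / 2 : ℝ) ^ ((n : ℝ) ^ (1 / 10 : ℝ)))
    + (2 * (n : ℝ) ^ 2 + 2) * Real.exp (-(n : ℝ))

set_option maxHeartbeats 1000000 in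
/-- The quantitative form of the theorem, for `n ^ 3 p ^ 5` at least and `n p ^ 2` at most a constant. -/
lemma subsetPr_isBad_le (hn : 11 ≤ Fintype.card V) {p : ℝ} (hp0 : 0 < p)
    (hlarge : 10 ^ 20 ≤ (Fintype.card V : ℝ) ^ 3 * p ^ 5)
    (hsmall : 100 * (Fintype.card V : ℝ) * p ^ 2 ≤ 1)
    (hn1 : 12288 * 6144 * ((Fintype.card V : ℝ) ^ (1 / 10 : ℝ) + 1) *
      (2 * Real.log (Fintype.card V) + 3) ≤ (Fintype.card V : ℝ) ^ (1 / 4 : ℝ))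
    (hn2 : 129024 * (2 * Real.log (Fintype.card V) + 3) * (Fintype.card V : ℝ) ^ (3 / 5 : ℝ) + 1
      ≤ (Fintype.card V : ℝ) ^ (2 / 3 : ℝ)) :
    subsetPr (vertexPairs V) p (IsBad p (1 / 10 ^ 18 * (Fintype.card V : ℝ) ^ 6 * p ^ 8))
      ≤ failureBound (Fintype.card V) := by
  have hch := choose_three_bounds (show 6 ≤ Fintype.card V by omega)
  set c : ℕ := (Fintype.card V).choose 3 with hc
  set n : ℝ := (Fintype.card V : ℝ) with hndef
  have hn11 : 11 ≤ n := by rw [hndef]; exact_mod_cast hn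
  have hn0 : 0 < n := by linarith
  have hlog : 0 ≤ Real.log n := Real.log_nonneg (by linarith)
  have hp32 : p ≤ 1 / 32 := by nlinarith
  have hp1 : p ≤ 1 := by linarith
  have hp2 : 0 < p ^ 2 := by positivity
  set x : ℝ := n ^ 3 * p ^ 3 with hx
  have hxp : n ^ 3 * p ^ 5 = x * p ^ 2 := by rw [hx]; ring
  -- the expected degree into triangles is large
  have hdeg : 10 ^ 11 ≤ n ^ 2 * p ^ 3 := by
    have h1 : (n ^ 2 * p ^ 3) ^ 5 = (n ^ 3 * p ^ 5) ^ 3 * n := by ring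
    have h2 : ((10 : ℝ) ^ 11) ^ 5 ≤ (n ^ 2 * p ^ 3) ^ 5 := by
      rw [h1]
      calc ((10 : ℝ) ^ 11) ^ 5 ≤ (10 ^ 20) ^ 3 * 1 := by norm_num
        _ ≤ (n ^ 3 * p ^ 5) ^ 3 * n := by gcongr; linarith
    exact le_of_pow_le_pow_left₀ (by norm_num) (by positivity) h2
  have hxn : 10 ^ 11 * n ≤ x := by
    have : x = n * (n ^ 2 * p ^ 3) := by rw [hx]; ring
    rw [this]
    nlinarith
  set k : ℕ := ⌊x / 6144⌋₊ with hk
  have hk1 : (k : ℝ) ≤ x / 6144 := Nat.floor_le (by positivity)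
  have hk2 : x / 6144 < k + 1 := Nat.lt_floor_add_one _
  have hkx : x ≤ 12288 * k := by linarith
  have hpc1 : 512 * (k : ℝ) ≤ p ^ 3 * c := by
    have : p ^ 3 * n ^ 3 ≤ p ^ 3 * (12 * c) := by gcongr; exact hch.1
    nlinarith
  have hpc2 : p ^ 3 * c + 3 * k ≤ 3 * 10 ^ 8 * (k : ℝ) := by
    have : p ^ 3 * (6 * c) ≤ p ^ 3 * n ^ 3 := by gcongr; exact hch.2
    nlinarith
  have hkn : 16 * n ≤ k := by linarith
  have hkn' : 16 * Fintype.card V ≤ k := by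
    rw [hndef] at hkn
    exact_mod_cast hkn
  have hpk : n ^ 3 * p ^ 5 ≤ 12288 * (p ^ 2 * k) := by rw [hxp]; nlinarith
  have hz : 4 * 10 ^ 9 * (1 / 10 ^ 18 * n ^ 6 * p ^ 8) ≤ p ^ 2 * (k : ℝ) ^ 2 := by
    have h1 : n ^ 6 * p ^ 8 = p ^ 2 * x ^ 2 := by rw [hx]; ring
    have h2 : x ^ 2 ≤ (12288 * k) ^ 2 := by gcongr
    have h3 : p ^ 2 * x ^ 2 ≤ p ^ 2 * (12288 * k) ^ 2 := by gcongr
    rw [mul_assoc (1 / 10 ^ 18 : ℝ), h1]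
    nlinarith
  have hz0 : 0 ≤ 1 / 10 ^ 18 * n ^ 6 * p ^ 8 := by positivity
  have htri : Real.exp (-(p ^ 3 * c) / 32) ≤ Real.exp (-n) := Real.exp_le_exp.2 (by linarith)
  have hbase : ∀ κ, HasWitnessFamily V p κ (1 / 10 ^ 18 * n ^ 6 * p ^ 8) (3 * 10 ^ 8) k
      (Real.exp (-n)) := fun κ =>
    (hasWitnessFamily_triangles hp0 hp1 (by rw [← hndef]; linarith) κ _ k hpc1 hpc2).mono htri
  have hpn35 : n ^ (-(3 / 5) : ℝ) ≤ p := by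
    have h1 : (n ^ (-(3 / 5) : ℝ)) ^ 5 ≤ p ^ 5 := by
      rw [← Real.rpow_natCast, ← Real.rpow_mul hn0.le]
      norm_num
      rw [inv_le_iff_one_le_mul₀ (by positivity)]
      linarith
    exact le_of_pow_le_pow_left₀ (by norm_num) hp0.le h1
  have htyp := fun κ => subsetPr_not_isTypical_le (V := V) hp0.le hp32 κ
  rw [← hndef] at htyp
  have hfin : ∀ m : ℕ, k ≤ m → ((n ^ 2 + 1) * Real.exp (-2 * m) ≤ (n ^ 2 + 1) * Real.exp (-n)) := by
    intro m hm
    have hm' : (k : ℝ) ≤ m := by exact_mod_cast hm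
    gcongr
    linarith
  have hz1 : 0 ≤ n ^ 2 * (1 / 2 : ℝ) ^ (n ^ (1 / 10 : ℝ)) := by positivity
  have hz2 : 0 ≤ n ^ (-(1 / 10) : ℝ) := by positivity
  have hexp0 : 0 < Real.exp (-n) := Real.exp_pos _
  unfold failureBound
  rw [← hndef]
  rcases le_or_gt (n ^ (-(11 / 20) : ℝ)) p with hcase | hcase
  · -- dense case: the triangles alone already force many edges into `R`
    set κ : ℕ := ⌈n ^ (1 / 10 : ℝ)⌉₊ with hκ
    have hκ1 : n ^ (1 / 10 : ℝ) ≤ κ := Nat.le_ceil _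
    have hκ2 : (κ : ℝ) < n ^ (1 / 10 : ℝ) + 1 := Nat.ceil_lt_add_one (by positivity)
    have hκ0 : 1 ≤ κ := Nat.one_le_ceil_iff.2 (by positivity)
    have hlow : 6144 * κ * (2 * Real.log n + 3) ≤ p ^ 2 * k := by
      have h1 : n ^ (1 / 4 : ℝ) ≤ n ^ 3 * p ^ 5 := by
        have h2 : (n ^ (-(11 / 20) : ℝ)) ^ 5 ≤ p ^ 5 := by gcongr
        rw [← Real.rpow_natCast, ← Real.rpow_mul hn0.le] at h2
        calc n ^ (1 / 4 : ℝ) = n ^ (3 : ℝ) * n ^ (-(11 / 20) * (5 : ℕ) : ℝ) := by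
              rw [← Real.rpow_add hn0]; norm_num
          _ ≤ n ^ (3 : ℝ) * p ^ 5 := by gcongr
          _ = n ^ 3 * p ^ 5 := by norm_cast
      have h2 : 12288 * 6144 * (κ : ℝ) * (2 * Real.log n + 3)
          ≤ 12288 * 6144 * (n ^ (1 / 10 : ℝ) + 1) * (2 * Real.log n + 3) := by gcongr
      linarith
    have hκp : n ^ 2 * (n * p ^ 2) ^ κ ≤ n ^ 2 * (1 / 2 : ℝ) ^ (n ^ (1 / 10 : ℝ)) := by
      refine mul_le_mul_of_nonneg_left ?_ (by positivity)
      calc (n * p ^ 2) ^ κ ≤ (1 / 2 : ℝ) ^ κ := by gcongr; linarith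
        _ = (1 / 2 : ℝ) ^ (κ : ℝ) := (Real.rpow_natCast _ _).symm
        _ ≤ (1 / 2 : ℝ) ^ (n ^ (1 / 10 : ℝ)) :=
            Real.rpow_le_rpow_of_exponent_ge (by norm_num) (by norm_num) hκ1
    have h := (hbase κ).subsetPr_isBad_le hp0 hp32 hκ0 (by omega) hkn' hlow (by linarith)
    have h1 := hfin k le_rfl
    have h2 := htyp κ
    rw [← hndef] at h
    have h3 : 0 ≤ n ^ 2 * Real.exp (-n) := by positivity
    linarith
  · -- sparse case: the forced part of `R` is grown until its size is at least `t`
    set L : ℝ := 2 * Real.log n + 3 with hL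
    have hL3 : 3 ≤ L := by linarith
    set t : ℕ := ⌈129024 * L / p ^ 2⌉₊ with ht
    have ht1 : 129024 * L / p ^ 2 ≤ t := Nat.le_ceil _
    have ht2 : (t : ℝ) < 129024 * L / p ^ 2 + 1 := Nat.ceil_lt_add_one (by positivity)
    have hpt : p * t ≤ n ^ (2 / 3 : ℝ) := by
      have h1 : p * t ≤ 129024 * L * p⁻¹ + p := by
        calc p * t ≤ p * (129024 * L / p ^ 2 + 1) := by gcongr
          _ = 129024 * L * p⁻¹ + p := by field_simp
      have h2 : p⁻¹ ≤ n ^ (3 / 5 : ℝ) := by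
        rw [inv_le_comm₀ hp0 (by positivity), ← Real.rpow_neg hn0.le]
        exact hpn35
      have h3 : 129024 * L * p⁻¹ ≤ 129024 * L * n ^ (3 / 5 : ℝ) := by gcongr
      linarith
    have hptn : p * t * √(p * t) ≤ n := by
      calc p * t * √(p * t) ≤ n ^ (2 / 3 : ℝ) * √(n ^ (2 / 3 : ℝ)) := by gcongr
        _ = n := by
          rw [Real.sqrt_eq_rpow, ← Real.rpow_mul hn0.le, ← Real.rpow_add hn0]
          norm_num
    have htn : (t : ℝ) ≤ n ^ 2 := by
      have h1 : n ^ (2 / 3 : ℝ) ≤ n := by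
        calc n ^ (2 / 3 : ℝ) ≤ n ^ (1 : ℝ) :=
              Real.rpow_le_rpow_of_exponent_le (by linarith) (by norm_num)
          _ = n := Real.rpow_one n
      have h2 : n⁻¹ ≤ p := by
        refine le_trans ?_ hpn35
        rw [← Real.rpow_neg_one]
        exact Real.rpow_le_rpow_of_exponent_le (by linarith) (by norm_num)
      have h3 : n⁻¹ * t ≤ n := le_trans (by gcongr) (hpt.trans h1)
      rw [inv_mul_le_iff₀ hn0] at h3
      nlinarith
    obtain ⟨m, hm, hgrow⟩ := (hbase 21).grow hp0 hp1 le_rfl (m₀ := k) (t := t) (by omega) hkn'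
      (by linarith) hptn hz le_rfl
    have hmt : (t : ℝ) ≤ m := by exact_mod_cast (le_max_left t k).trans hm
    have hmk' : k ≤ m := (le_max_right t k).trans hm
    have hmk : (k : ℝ) ≤ m := by exact_mod_cast hmk'
    have hlow : 6144 * (21 : ℕ) * L ≤ p ^ 2 * m := by
      rw [div_le_iff₀ hp2] at ht1
      push_cast
      nlinarith
    have hz' : 1024 * (1 / 10 ^ 18 * n ^ 6 * p ^ 8) ≤ p ^ 2 * (m : ℝ) ^ 2 := by
      have : p ^ 2 * (k : ℝ) ^ 2 ≤ p ^ 2 * (m : ℝ) ^ 2 := by gcongr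
      linarith
    have hκp : n ^ 2 * (n * p ^ 2) ^ 21 ≤ n ^ (-(1 / 10) : ℝ) := by
      have h1 : n * p ^ 2 ≤ n ^ (-(1 / 10) : ℝ) := by
        calc n * p ^ 2 ≤ n * (n ^ (-(11 / 20) : ℝ)) ^ 2 := by gcongr
          _ = n ^ (1 : ℝ) * n ^ (-(11 / 20) * (2 : ℕ) : ℝ) := by
              rw [Real.rpow_one, Real.rpow_mul hn0.le, Real.rpow_natCast]
          _ = n ^ (-(1 / 10) : ℝ) := by rw [← Real.rpow_add hn0]; norm_num
      calc n ^ 2 * (n * p ^ 2) ^ 21 ≤ n ^ 2 * (n ^ (-(1 / 10) : ℝ)) ^ 21 := by gcongr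
        _ = n ^ ((2 : ℕ) : ℝ) * n ^ (-(1 / 10) * (21 : ℕ) : ℝ) := by
            rw [Real.rpow_natCast, Real.rpow_mul hn0.le, Real.rpow_natCast]
        _ = n ^ (-(1 / 10) : ℝ) := by rw [← Real.rpow_add hn0]; norm_num
    have h := hgrow.subsetPr_isBad_le hp0 hp32 (by norm_num) (by omega) (hkn'.trans hmk') hlow hz'
    have h1 := hfin m hmk'
    have h2 := htyp 21
    have h3 : ((t - k : ℕ) : ℝ) * Real.exp (-(k : ℝ)) ≤ n ^ 2 * Real.exp (-n) := by
      have h4 : ((t - k : ℕ) : ℝ) ≤ n ^ 2 := le_trans (by exact_mod_cast Nat.sub_le t k) htn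
      have h5 : Real.exp (-(k : ℝ)) ≤ Real.exp (-n) := Real.exp_le_exp.2 (by linarith)
      exact mul_le_mul h4 h5 (Real.exp_pos _).le (by positivity)
    rw [← hndef] at h
    linarith

end Quantitative

/-! ### From random subsets to colourings of the random graph -/

section Translation

variable {V : Type} [Fintype V] [LinearOrder V]

/-- The edge set of `G` as a finite set. -/
noncomputable def edges (G : SimpleGraph V) : Finset (Sym2 V) := G.edgeSet.toFinite.toFinset

omit [LinearOrder V] in
lemma mem_edges {G : SimpleGraph V} {e : Sym2 V} : e ∈ edges G ↔ e ∈ G.edgeSet := by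
  simp [edges]

/-- The edge set of the binomial random graph is a random subset of the pairs of vertices. -/
lemma binomialRandom_real_eq_subsetPr (p : unitInterval) (A : Finset (Sym2 V) → Prop) :
    (SimpleGraph.binomialRandom V p).real {G | A (edges G)} = subsetPr (vertexPairs V) p A := by
  classical
  set U := vertexPairs V with hU
  have hUdiag : (U : Set (Sym2 V)) = Sym2.diagSetᶜ := by
    ext e
    simp [hU, vertexPairs]
  have h1 : SimpleGraph.edgeSet '' {G : SimpleGraph V | A (edges G)}
      = ((U.powerset.filter A).image fun N : Finset (Sym2 V) => (N : Set (Sym2 V)) :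
        Finset (Set (Sym2 V))) := by
    ext B
    simp only [Set.mem_image, Set.mem_ofPred_eq, coe_image, coe_filter, mem_powerset]
    constructor
    · rintro ⟨G, hG, rfl⟩
      refine ⟨edges G, ⟨fun e he => ?_, hG⟩, by ext e; simp [mem_edges]⟩
      simpa [hU, vertexPairs] using G.not_isDiag_of_mem_edgeSet (mem_edges.1 he)
    · rintro ⟨N, ⟨hNU, hN⟩, rfl⟩
      have h2 : (SimpleGraph.fromEdgeSet (N : Set (Sym2 V))).edgeSet = N := by
        rw [SimpleGraph.edgeSet_fromEdgeSet]
        ext e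
        simp only [Set.mem_sdiff, mem_coe, and_iff_left_iff_imp]
        intro he
        simpa [hU, vertexPairs] using hNU he
      refine ⟨SimpleGraph.fromEdgeSet N, ?_, h2⟩
      have h3 : edges (SimpleGraph.fromEdgeSet (N : Set (Sym2 V))) = N := by
        ext e
        rw [mem_edges, h2, mem_coe]
      rw [h3]
      exact hN
  rw [MeasureTheory.measureReal_def, SimpleGraph.binomialRandom_apply', h1,
    ← MeasureTheory.measureReal_def, ← MeasureTheory.sum_measureReal_singleton,
    sum_image fun _ _ _ _ h => by exact_mod_cast h, subsetPr, subsetEx, sum_filter]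
  refine sum_congr rfl fun N hN => ?_
  split_ifs with hA
  · have hNU := mem_powerset.1 hN
    rw [← hUdiag, ProbabilityTheory.setBernoulli_real_singleton p (by exact_mod_cast hNU)
      U.finite_toSet, ← coe_sdiff, Set.ncard_coe_finset, Set.ncard_coe_finset,
      card_sdiff_of_subset hNU, mul_one]
  · rw [mul_zero]

variable {G : SimpleGraph V}

omit [LinearOrder V] in
/-- The red edges of a colouring, as a finite set of pairs. -/
lemma exists_redEdges (φ : RBColouring G) : ∃ R ⊆ edges G,
    (∀ x y, s(x, y) ∈ R ↔ (φ.labelGraph .red).Adj x y) ∧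
    (∀ x y, s(x, y) ∈ edges G → s(x, y) ∉ R → (φ.labelGraph .blue).Adj x y) ∧
    #R = φ.colourCount .red := by
  classical
  set R : Finset (Sym2 V) := {e | ∃ h : e ∈ G.edgeSet, φ ⟨e, h⟩ = .red} with hR
  have hmem : ∀ e, e ∈ R ↔ ∃ h : e ∈ G.edgeSet, φ ⟨e, h⟩ = .red := fun e => by simp [hR]
  refine ⟨R, fun e he => mem_edges.2 ((hmem e).1 he).1, fun x y => ?_, fun x y he hnot => ?_, ?_⟩
  · rw [hmem, SimpleGraph.EdgeLabeling.labelGraph_adj]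
    rfl
  · rw [SimpleGraph.EdgeLabeling.labelGraph_adj]
    have he' := mem_edges.1 he
    refine ⟨he', ?_⟩
    cases hφ : φ ⟨s(x, y), he'⟩ with
    | red => exact absurd ((hmem _).2 ⟨he', hφ⟩) hnot
    | blue => rfl
  · have h1 : (R : Set (Sym2 V)) = Subtype.val '' {e : G.edgeSet | φ e = .red} := by
      ext e
      rw [mem_coe, hmem]
      simp
    rw [RBColouring.colourCount, ← Set.ncard_coe_finset, h1,
      Set.ncard_image_of_injective _ Subtype.val_injective]

lemma hitsTriangles_of_isTriangleFree {φ : RBColouring G} (hφ : φ.IsTriangleFree)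
    {R : Finset (Sym2 V)}
    (hB : ∀ x y, s(x, y) ∈ edges G → s(x, y) ∉ R → (φ.labelGraph .blue).Adj x y) :
    HitsTriangles (edges G) R := by
  intro S hS hSN hd
  refine hφ .blue S ⟨?_, hS⟩
  intro x hx y hy hxy
  have h : s(x, y) ∈ cliqueEdges S := by
    simp only [cliqueEdges, mem_filter, mk_mem_sym2_iff, Sym2.mk_isDiag_iff]
    exact ⟨⟨hx, hy⟩, hxy⟩
  exact hB x y (hSN h) (Finset.disjoint_left.1 hd h)

/-- Different mixed cycles have different edge sets: their red and blue edges determine both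
middle vertices and the pair of opposite vertices. -/
lemma card_mixedCycles_le_rrbbCount (φ : RBColouring G) {R : Finset (Sym2 V)}
    (hR : ∀ x y, s(x, y) ∈ R ↔ (φ.labelGraph .red).Adj x y)
    (hB : ∀ x y, s(x, y) ∈ edges G → s(x, y) ∉ R → (φ.labelGraph .blue).Adj x y) :
    #(mixedCycles (edges G) R) ≤ φ.rrbbCount := by
  classical
  rw [RBColouring.rrbbCount, ← Set.ncard_coe_finset]
  refine Set.ncard_le_ncard_of_injOn (fun q => {s(q.1.2.1, q.1.1), s(q.1.1, q.1.2.2),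
    s(q.1.2.2, q.2), s(q.2, q.1.2.1)}) ?_ ?_ (Set.toFinite _)
  · rintro ⟨⟨u, x, y⟩, v⟩ hq
    obtain ⟨-, ⟨h1, h2, h3⟩, h4, h5, h6⟩ := mem_filter.1 (mem_coe.1 hq)
    simp only [closing, insert_subset_iff, singleton_subset_iff, mem_sdiff] at h1 h2 h3 h4 h5 h6
    refine ⟨x, u, y, v, h1.ne, ?_, (hR x u).1 h2, ((hR y u).1 h3).symm,
      hB y v h6.2.1 h6.2.2, (hB x v h6.1.1 h6.1.2).symm, rfl⟩
    rintro rfl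
    exact h6.1.2 h2
  · rintro ⟨⟨u, x, y⟩, v⟩ hq ⟨⟨u', x', y'⟩, v'⟩ hq' h
    obtain ⟨-, ⟨h1, h2, h3⟩, h4, h5, h6⟩ := mem_filter.1 (mem_coe.1 hq)
    obtain ⟨-, ⟨h1', h2', h3'⟩, h4', h5', h6'⟩ := mem_filter.1 (mem_coe.1 hq')
    simp only [closing, insert_subset_iff, singleton_subset_iff, mem_sdiff]
      at h1 h2 h3 h4 h5 h6 h1' h2' h3' h4' h5' h6'
    simp only at h
    rw [Sym2.eq_swap (a := u), Sym2.eq_swap (a := v), Sym2.eq_swap (a := u'),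
      Sym2.eq_swap (a := v')] at h
    have hmem := fun e => Set.ext_iff.1 h e
    simp only [Set.mem_insert_iff, Set.mem_singleton_iff] at hmem
    have hux : u ≠ x := ((hR x u).1 h2).ne.symm
    have huy : u ≠ y := ((hR y u).1 h3).ne.symm
    have hred : ∀ e, (e = s(x, u) ∨ e = s(y, u)) ↔ (e = s(x', u') ∨ e = s(y', u')) := by
      intro e
      have := hmem e
      grind
    have hblue : ∀ e, (e = s(x, v) ∨ e = s(y, v)) ↔ (e = s(x', v') ∨ e = s(y', v')) := by
      intro e
      have := hmem e
      grind
    obtain ⟨rfl, rfl, rfl⟩ := closing_injective h1 h1' hux huy hred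
    obtain ⟨-, -, rfl⟩ := closing_injective h1 h1' h4 h5 hblue
    rfl

/-- If the edge set of `G` is not bad, then all colourings considered have many `4`-cycles. -/
lemma le_rrbbCount_of_not_isBad {p z : ℝ} (hG : ¬ IsBad p z (edges G)) (φ : RBColouring G)
    (hφ : φ.IsTriangleFree)
    (hred : (φ.colourCount .red : ℝ) < 1 / 10 ^ 20 * (Fintype.card V : ℝ) ^ 2 * p) :
    z ≤ φ.rrbbCount := by
  obtain ⟨R, hRN, hR, hB, hcard⟩ := exists_redEdges φ
  by_contra! hlt
  refine hG ⟨R, hRN, hitsTriangles_of_isTriangleFree hφ hB, ?_, ?_⟩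
  · rw [hcard]
    linarith
  · refine lt_of_le_of_lt ?_ hlt
    exact_mod_cast card_mixedCycles_le_rrbbCount φ hR hB

end Translation

section Asymptotics

open Filter Topology

lemma tendsto_failureBound : Tendsto failureBound atTop (𝓝 0) := by
  have hcast := tendsto_natCast_atTop_atTop (R := ℝ)
  have h1 : Tendsto (fun n : ℕ => (n : ℝ) * Real.exp (-(n : ℝ) / 20)) atTop (𝓝 0) := by
    refine ((tendsto_rpow_mul_exp_neg_mul_atTop_nhds_zero 1 (1 / 20) (by norm_num)).comp
      hcast).congr fun n => ?_
    simp only [Function.comp_apply, Real.rpow_one]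
    ring_nf
  have h2 : Tendsto (fun n : ℕ => (1 / 2 : ℝ) ^ n) atTop (𝓝 0) :=
    tendsto_pow_atTop_nhds_zero_of_lt_one (by norm_num) (by norm_num)
  have h3 : Tendsto (fun n : ℕ => (n : ℝ) ^ (-(1 / 10) : ℝ)) atTop (𝓝 0) :=
    (tendsto_rpow_neg_atTop (by norm_num)).comp hcast
  have h4 : Tendsto (fun n : ℕ => (n : ℝ) ^ 2 * (1 / 2 : ℝ) ^ ((n : ℝ) ^ (1 / 10 : ℝ)))
      atTop (𝓝 0) := by
    refine ((tendsto_rpow_mul_exp_neg_mul_atTop_nhds_zero 20 (Real.log 2)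
      (Real.log_pos (by norm_num))).comp
      ((tendsto_rpow_atTop (show (0 : ℝ) < 1 / 10 by norm_num)).comp hcast)).congr fun n => ?_
    have hn : (0 : ℝ) ≤ n := by positivity
    simp only [Function.comp_apply]
    rw [← Real.rpow_mul hn, Real.rpow_def_of_pos (show (0 : ℝ) < 1 / 2 by norm_num)]
    rw [one_div (2 : ℝ), Real.log_inv]
    norm_num
  have h5 : Tendsto (fun n : ℕ => (2 * (n : ℝ) ^ 2 + 2) * Real.exp (-(n : ℝ))) atTop (𝓝 0) := by
    have h6 := ((tendsto_rpow_mul_exp_neg_mul_atTop_nhds_zero 2 1 one_pos).comp hcast).const_mul 2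
    have h7 := ((tendsto_rpow_mul_exp_neg_mul_atTop_nhds_zero 0 1 one_pos).comp hcast).const_mul 2
    have h8 := h6.add h7
    simp only [mul_zero, add_zero] at h8
    refine h8.congr fun n => ?_
    simp only [Function.comp_apply, Real.rpow_zero, Real.rpow_ofNat]
    ring_nf
  have h := ((h1.add h2).add (h3.add h4)).add h5
  rw [add_zero, add_zero, add_zero] at h
  exact h

lemma eventually_growth_conditions : ∀ᶠ n : ℕ in atTop,
    12288 * 6144 * ((n : ℝ) ^ (1 / 10 : ℝ) + 1) * (2 * Real.log n + 3) ≤ (n : ℝ) ^ (1 / 4 : ℝ) ∧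
    129024 * (2 * Real.log n + 3) * (n : ℝ) ^ (3 / 5 : ℝ) + 1 ≤ (n : ℝ) ^ (2 / 3 : ℝ) := by
  have hlog : ∀ᶠ x : ℝ in atTop, Real.log x ≤ x ^ (1 / 20 : ℝ) := by
    filter_upwards [(isLittleO_log_rpow_atTop (show (0 : ℝ) < 1 / 20 by norm_num)).bound one_pos,
      eventually_ge_atTop 1] with x hx hx1
    rw [one_mul, Real.norm_eq_abs, Real.norm_eq_abs, abs_of_nonneg (Real.log_nonneg hx1),
      abs_of_nonneg (by positivity)] at hx
    exact hx
  have h : ∀ᶠ x : ℝ in atTop,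
      12288 * 6144 * (x ^ (1 / 10 : ℝ) + 1) * (2 * Real.log x + 3) ≤ x ^ (1 / 4 : ℝ) ∧
      129024 * (2 * Real.log x + 3) * x ^ (3 / 5 : ℝ) + 1 ≤ x ^ (2 / 3 : ℝ) := by
    filter_upwards [hlog, eventually_ge_atTop 1,
      (tendsto_rpow_atTop (show (0 : ℝ) < 1 / 60 by norm_num)).eventually_ge_atTop (10 ^ 9)]
      with x hx hx1 hx2
    have hx0 : 0 < x := by linarith
    -- all powers are expressed through the one which exceeds all constants
    set w : ℝ := x ^ (1 / 60 : ℝ) with hw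
    have hpow : ∀ k : ℕ, x ^ ((k : ℝ) / 60) = w ^ k := fun k => by
      rw [hw, ← Real.rpow_natCast, ← Real.rpow_mul hx0.le]
      ring_nf
    have e1 : x ^ (1 / 20 : ℝ) = w ^ 3 := by rw [← hpow]; norm_num
    have e2 : x ^ (1 / 10 : ℝ) = w ^ 6 := by rw [← hpow]; norm_num
    have e3 : x ^ (1 / 4 : ℝ) = w ^ 15 := by rw [← hpow]; norm_num
    have e4 : x ^ (3 / 5 : ℝ) = w ^ 36 := by rw [← hpow]; norm_num
    have e5 : x ^ (2 / 3 : ℝ) = w ^ 40 := by rw [← hpow]; norm_num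
    rw [e1] at hx
    rw [e2, e3, e4, e5]
    have hw1 : 1 ≤ w := by linarith
    have hL : 2 * Real.log x + 3 ≤ 5 * w ^ 3 := by
      have : 1 ≤ w ^ 3 := one_le_pow₀ hw1
      linarith
    have hL0 : 0 ≤ 2 * Real.log x + 3 := by
      have := Real.log_nonneg hx1
      linarith
    constructor
    · have h6 : 1 ≤ w ^ 6 := one_le_pow₀ hw1
      calc 12288 * 6144 * (w ^ 6 + 1) * (2 * Real.log x + 3)
          ≤ 12288 * 6144 * (w ^ 6 + w ^ 6) * (5 * w ^ 3) := by gcongr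
        _ = (12288 * 6144 * 10) * w ^ 9 := by ring
        _ ≤ w * w ^ 9 := by
          have : (12288 * 6144 * 10 : ℝ) ≤ 10 ^ 9 := by norm_num
          gcongr
          linarith
        _ = w ^ 10 := by ring
        _ ≤ w ^ 15 := pow_le_pow_right₀ hw1 (by norm_num)
    · have h6 : 1 ≤ w ^ 39 := one_le_pow₀ hw1
      calc 129024 * (2 * Real.log x + 3) * w ^ 36 + 1
          ≤ 129024 * (5 * w ^ 3) * w ^ 36 + w ^ 39 := by gcongr
        _ = (129024 * 5 + 1) * w ^ 39 := by ring
        _ ≤ w * w ^ 39 := by gcongr; linarith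
        _ = w ^ 40 := by ring
  exact tendsto_natCast_atTop_atTop.eventually h

end Asymptotics

theorem mainTheorem8 :
    ∃ β ζ : ℝ, 0 < β ∧ 0 < ζ ∧
      ∀ p : ℕ → unitInterval,
        Asymptotics.IsLittleO Filter.atTop
          (fun n : ℕ => (n : ℝ) ^ (-(3 / 5) : ℝ)) (fun n : ℕ => (p n : ℝ)) →
        Asymptotics.IsLittleO Filter.atTop
          (fun n : ℕ => (p n : ℝ)) (fun n : ℕ => (n : ℝ) ^ (-(1 / 2) : ℝ)) →
        Filter.Tendsto
          (fun n : ℕ => SimpleGraph.binomialRandom (Fin n) (p n)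
            {G : SimpleGraph (Fin n) |
              ∀ φ : RBColouring G, φ.IsTriangleFree →
                (φ.colourCount .red : ℝ) < β * (n : ℝ) ^ 2 * (p n : ℝ) →
                ζ * (n : ℝ) ^ 6 * (p n : ℝ) ^ 8 ≤ (φ.rrbbCount : ℝ)})
          Filter.atTop (nhds 1) := by
  refine ⟨1 / 10 ^ 20, 1 / 10 ^ 18, by norm_num, by norm_num, fun p hp1 hp2 => ?_⟩
  have hlim : Filter.Tendsto (fun n => ENNReal.ofReal (1 - failureBound n)) Filter.atTop
      (nhds 1) := by
    have h := ENNReal.tendsto_ofReal (tendsto_failureBound.const_sub 1)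
    simpa using h
  refine tendsto_of_tendsto_of_tendsto_of_le_of_le' hlim tendsto_const_nhds ?_
    (Filter.Eventually.of_forall fun n => MeasureTheory.prob_le_one)
  filter_upwards [hp1.bound (show (0 : ℝ) < 1 / 10 ^ 4 by norm_num),
    hp2.bound (show (0 : ℝ) < 1 / 10 by norm_num), eventually_growth_conditions,
    Filter.eventually_ge_atTop 11] with n h1 h2 h3 hn
  have hn0 : (0 : ℝ) < n := by
    have : 0 < n := by omega
    exact_mod_cast this
  have hpn0 : (0 : ℝ) ≤ p n := (p n).2.1
  rw [Real.norm_of_nonneg (by positivity), Real.norm_of_nonneg hpn0] at h1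
  rw [Real.norm_of_nonneg hpn0, Real.norm_of_nonneg (by positivity)] at h2
  have hpos : (0 : ℝ) < p n := by
    have : (0 : ℝ) < (n : ℝ) ^ (-(3 / 5) : ℝ) := by positivity
    linarith
  have hlarge : 10 ^ 20 ≤ (n : ℝ) ^ 3 * (p n : ℝ) ^ 5 := by
    have h4 : ((n : ℝ) ^ (-(3 / 5) : ℝ)) ^ 5 ≤ (1 / 10 ^ 4 * (p n : ℝ)) ^ 5 := by gcongr
    rw [← Real.rpow_natCast, ← Real.rpow_mul hn0.le] at h4
    norm_num at h4
    rw [inv_le_iff_one_le_mul₀ (by positivity)] at h4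
    rw [mul_pow] at h4
    norm_num at h4
    linarith
  have hsmall : 100 * (n : ℝ) * (p n : ℝ) ^ 2 ≤ 1 := by
    have h4 : (p n : ℝ) ^ 2 ≤ (1 / 10 * (n : ℝ) ^ (-(1 / 2) : ℝ)) ^ 2 := by gcongr
    have h5 : ((n : ℝ) ^ (-(1 / 2) : ℝ)) ^ 2 = (n : ℝ)⁻¹ := by
      rw [← Real.rpow_natCast, ← Real.rpow_mul hn0.le, ← Real.rpow_neg_one]
      norm_num
    rw [mul_pow, h5] at h4
    calc 100 * (n : ℝ) * (p n : ℝ) ^ 2 ≤ 100 * (n : ℝ) * ((1 / 10) ^ 2 * (n : ℝ)⁻¹) := by gcongr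
      _ = 1 := by field_simp; norm_num
  have hbad := subsetPr_isBad_le (V := Fin n) (p := p n) (by simpa using hn) hpos
    (by simpa using hlarge) (by simpa using hsmall) (by simpa using h3.1) (by simpa using h3.2)
  rw [Fintype.card_fin] at hbad
  set z : ℝ := 1 / 10 ^ 18 * (n : ℝ) ^ 6 * (p n : ℝ) ^ 8
  have hgood := binomialRandom_real_eq_subsetPr (V := Fin n) (p n)
    (fun N => ¬ IsBad (p n) z N)
  rw [subsetPr_compl] at hgood
  calc ENNReal.ofReal (1 - failureBound n)
      ≤ ENNReal.ofReal ((SimpleGraph.binomialRandom (Fin n) (p n)).real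
          {G | ¬ IsBad (p n) z (edges G)}) := by
        refine ENNReal.ofReal_le_ofReal ?_
        rw [hgood]
        linarith
    _ = SimpleGraph.binomialRandom (Fin n) (p n) {G | ¬ IsBad (p n) z (edges G)} :=
        MeasureTheory.ofReal_measureReal
    _ ≤ _ := by
        refine MeasureTheory.measure_mono fun G hG φ hφ hred => ?_
        refine le_rrbbCount_of_not_isBad hG φ hφ ?_
        rwa [Fintype.card_fin]
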